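/- For $\alpha\in[0,\pi)$ and a finite Radon measure $\mu$ on $[0,\infty)$, i.e. a finite signed measure on the Borel $\sigma$-algebra of $[0,\infty)$, let $a_\alpha^\mu$ be the sesquilinear form in $L^2([0,\infty))$ given, for $\alpha\neq 0$, by $$D(a_\alpha^\mu)=H^1([0,\infty)),\qquad a_\alpha^\mu(f,g)=\int_0^\infty f'(x)\overline{g'(x)}\,dx-\cot(\alpha)f(0)\overline{g(0)}+\int_{[0,\infty)}f\overline{g}\,d\mu,$$ and, for $\alpha=0$, by $$D(a_0^\mu)=H^1_0([0,\infty))=\{f\in H^1([0,\infty)): f(0)=0\},\qquad a_0^\mu(f,g)=\int_0^\infty f'(x)\overline{g'(x)}\,dx+\int_{[0,\infty)}f\overline{g}\,d\mu,$$ where elements of $H^1([0,\infty))$ are identified with their continuous representatives. Let $-\Delta_\alpha+\mu$ be the operator in $L^2([0,\infty))$ associated to $a_\alpha^\mu$ in the sense of Kato's first representation theorem: its domain consists of those $f\in D(a_\alpha^\mu)$ for which there is an $h\in L^2([0,\infty))$ with $a_\alpha^\mu(f,g)=\langle h,g\rangle$ for all $g\in D(a_\alpha^\mu)$, and then $(-\Delta_\alpha+\mu)f=h$.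 **Theorem.** Let $\alpha\in[0,\pi)$, and let $\mu_n$, $n\in\mathbb{N}$, and $\mu$ be finite Radon measures on $[0,\infty)$ without point mass at $0$. Suppose that $\mu_n\to\mu$ weakly, i.e. $\int_{[0,\infty)} f\,d\mu_n\to\int_{[0,\infty)} f\,d\mu$ for every bounded continuous function $f$ on $[0,\infty)$. Then the operators $-\Delta_\alpha+\mu_n$ and $-\Delta_\alpha+\mu$ are self-adjoint, and $-\Delta_\alpha+\mu_n\to-\Delta_\alpha+\mu$ in the norm resolvent sense, i.e. for every $z\in\mathbb{C}\setminus\mathbb{R}$ $$\big\|(-\Delta_\alpha+\mu_n-z)^{-1}-(-\Delta_\alpha+\mu-z)^{-1}\big\|\to 0\qquad(n\to\infty).$$ -/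

import Mathlib

open MeasureTheory Filter Topology Set
open scoped NNReal BoundedContinuousFunction ComplexConjugate ContDiff

/-- Lebesgue measure on the half-line `[0, ∞)`, as a measure on `ℝ` carried by `[0, ∞)`. -/
noncomputable abbrev halfLineVolume : Measure ℝ := volume.restrict (Ici (0 : ℝ))

/-- The Hilbert space `L²([0, ∞))` of complex-valued functions. -/
noncomputable abbrev HalfLineL2 : Type := Lp ℂ 2 halfLineVolume

/-- A function in the Sobolev space `H¹([0, ∞))`, given by its (absolutely) continuous
representative `toFun` on `[0, ∞)` together with its weak derivative `deriv`, an `L²` function: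
`toFun` is an indefinite integral of `deriv`. Only the values on `[0, ∞)` matter. -/
structure HalfLineH1 where
  /-- The continuous representative. -/
  toFun : ℝ → ℂ
  /-- The weak derivative. -/
  deriv : ℝ → ℂ
  memLp : MemLp toFun 2 halfLineVolume
  memLp_deriv : MemLp deriv 2 halfLineVolume
  eq_add_integral : ∀ x : ℝ, 0 ≤ x → toFun x = toFun 0 + ∫ t in (0 : ℝ)..x, deriv t

namespace HalfLineH1

/-- The class in `L²([0, ∞))` of an `H¹` function. -/
noncomputable def toL2 (u : HalfLineH1) : HalfLineL2 := u.memLp.toLp u.toFun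

/-- The form domain of `-Δ_α`: it is `H¹([0, ∞))` if `α ≠ 0`, and
`H¹₀([0, ∞)) = {u ∈ H¹([0, ∞)) : u(0) = 0}` if `α = 0`. -/
def InFormDomain (α : ℝ) (u : HalfLineH1) : Prop := α = 0 → u.toFun 0 = 0

/-- The sesquilinear form `a_α⁰` of the free operator `-Δ_α`. -/
noncomputable def freeForm (α : ℝ) (u v : HalfLineH1) : ℂ :=
  (∫ x in Ici (0 : ℝ), u.deriv x * conj (v.deriv x)) -
    (if α = 0 then 0 else (Real.cot α : ℂ) * (u.toFun 0 * conj (v.toFun 0)))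

/-- The sesquilinear form `a_α^μ(u, v) = a_α⁰(u, v) + ∫ u v̄ dμ`, where `μ` is a finite signed
Borel measure on `[0, ∞)`. -/
noncomputable def form (α : ℝ) (μ : SignedMeasure ℝ≥0) (u v : HalfLineH1) : ℂ :=
  freeForm α u v + ∫ᵛ x : ℝ≥0, u.toFun x * conj (v.toFun x) ∂<•μ

/-! ### Algebraic structure, integrability -/

lemma intervalIntegrable_deriv (u : HalfLineH1) {x y : ℝ} (hx : 0 ≤ x) (hy : 0 ≤ y) :
    IntervalIntegrable u.deriv volume x y := by
  have h : LocallyIntegrableOn u.deriv (Ici (0 : ℝ)) := by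
    have := (u.memLp_deriv.locallyIntegrable (by norm_num))
    exact locallyIntegrableOn_of_locallyIntegrable_restrict this
  rw [intervalIntegrable_iff']
  apply h.integrableOn_compact_subset _ isCompact_uIcc
  intro t ht
  exact (le_min hx hy).trans ht.1

noncomputable instance : Zero HalfLineH1 where
  zero :=
    { toFun := fun _ => 0
      deriv := fun _ => 0
      memLp := MemLp.zero'
      memLp_deriv := MemLp.zero'
      eq_add_integral := by simp }

noncomputable instance : Add HalfLineH1 where
  add u v :=
    { toFun := fun x => u.toFun x + v.toFun x
      deriv := fun x => u.deriv x + v.deriv x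
      memLp := u.memLp.add v.memLp
      memLp_deriv := u.memLp_deriv.add v.memLp_deriv
      eq_add_integral := fun x hx => by
        rw [intervalIntegral.integral_add (u.intervalIntegrable_deriv le_rfl hx)
          (v.intervalIntegrable_deriv le_rfl hx), u.eq_add_integral x hx, v.eq_add_integral x hx]
        ring }

noncomputable instance : SMul ℂ HalfLineH1 where
  smul c u :=
    { toFun := fun x => c * u.toFun x
      deriv := fun x => c * u.deriv x
      memLp := u.memLp.const_mul c
      memLp_deriv := u.memLp_deriv.const_mul c
      eq_add_integral := fun x hx => by
        rw [intervalIntegral.integral_const_mul, u.eq_add_integral x hx]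
        ring }

lemma zero_toFun (x : ℝ) : (0 : HalfLineH1).toFun x = 0 := rfl
lemma zero_deriv (x : ℝ) : (0 : HalfLineH1).deriv x = 0 := rfl
lemma add_toFun (u v : HalfLineH1) (x : ℝ) : (u + v).toFun x = u.toFun x + v.toFun x := rfl
lemma add_deriv (u v : HalfLineH1) (x : ℝ) : (u + v).deriv x = u.deriv x + v.deriv x := rfl
lemma smul_toFun (c : ℂ) (u : HalfLineH1) (x : ℝ) : (c • u).toFun x = c * u.toFun x := rfl
lemma smul_deriv (c : ℂ) (u : HalfLineH1) (x : ℝ) : (c • u).deriv x = c * u.deriv x := rfl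
lemma toL2_zero : (0 : HalfLineH1).toL2 = 0 := MemLp.toLp_zero _
lemma toL2_add (u v : HalfLineH1) : (u + v).toL2 = u.toL2 + v.toL2 := MemLp.toLp_add _ _
lemma toL2_smul (c : ℂ) (u : HalfLineH1) : (c • u).toL2 = c • u.toL2 :=
  MemLp.toLp_const_smul c u.memLp

lemma continuousOn (u : HalfLineH1) : ContinuousOn u.toFun (Ici 0) := by
  intro x hx
  have hx : (0 : ℝ) ≤ x := hx
  have h1 : ContinuousOn u.toFun (Icc 0 (x + 1)) := by
    have h2 : ContinuousOn (fun y => u.toFun 0 + ∫ t in (0 : ℝ)..y, u.deriv t)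
        (Icc 0 (x + 1)) := by
      refine continuousOn_const.add ?_
      have := intervalIntegral.continuousOn_primitive_interval (a := 0) (b := x + 1)
        (f := u.deriv) (μ := volume) (by
          have := ((intervalIntegrable_iff' (by simp)).1
            (u.intervalIntegrable_deriv le_rfl (show (0 : ℝ) ≤ x + 1 by linarith)))
          exact this)
      rwa [uIcc_of_le (by linarith)] at this
    exact h2.congr fun y hy => u.eq_add_integral y hy.1
  have h3 := h1 x ⟨hx, by linarith⟩
  refine h3.mono_of_mem_nhdsWithin ?_
  have : Iio (x + 1) ∈ 𝓝[Ici 0] x := mem_nhdsWithin_of_mem_nhds (Iio_mem_nhds (by linarith))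
  filter_upwards [this, self_mem_nhdsWithin] with y hy1 hy2
  exact ⟨hy2, le_of_lt hy1⟩

lemma continuous_comp_coe (u : HalfLineH1) : Continuous fun x : ℝ≥0 => u.toFun x :=
  u.continuousOn.comp_continuous NNReal.continuous_coe fun x => x.2

/-- An `H¹` function is bounded on `[0, ∞)`. -/
lemma exists_bound (u : HalfLineH1) : ∃ C : ℝ, ∀ x : ℝ, 0 ≤ x → ‖u.toFun x‖ ≤ C := by
  have hsq : ∀ {f : ℝ → ℂ}, MemLp f 2 halfLineVolume →
      IntegrableOn (fun x => ‖f x‖ ^ 2) (Ici (0 : ℝ)) := fun hf => by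
    exact hf.integrable_norm_pow (p := 2) (by norm_num)
  have key : ∀ {f : ℝ → ℂ}, MemLp f 2 halfLineVolume → ∀ x : ℝ, 0 ≤ x →
      ∫ t in x..(x + 1), ‖f t‖ ≤ 1 + ∫ t in Ici (0 : ℝ), ‖f t‖ ^ 2 := by
    intro f hf x hx
    have hsub : Ioc x (x + 1) ⊆ Ici (0 : ℝ) := fun t ht => hx.trans ht.1.le
    have hi := (hsq hf).mono_set hsub
    rw [intervalIntegral.integral_of_le (by linarith)]
    calc ∫ t in Ioc x (x + 1), ‖f t‖ ≤ ∫ t in Ioc x (x + 1), (1 + ‖f t‖ ^ 2) := by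
          refine integral_mono_of_nonneg (ae_of_all _ fun t => norm_nonneg _)
            (Integrable.add (by simp) hi) (ae_of_all _ fun t => ?_)
          have := sq_nonneg (‖f t‖ - 1)
          have := norm_nonneg (f t)
          simp only
          nlinarith
      _ = 1 + ∫ t in Ioc x (x + 1), ‖f t‖ ^ 2 := by
          rw [integral_add (by simp) hi]
          simp
      _ ≤ 1 + ∫ t in Ici (0 : ℝ), ‖f t‖ ^ 2 := by
          exact add_le_add le_rfl (setIntegral_mono_set (hsq hf)
            (ae_of_all _ fun t => sq_nonneg ‖f t‖) hsub.eventuallyLE)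
  refine ⟨(1 + ∫ t in Ici (0 : ℝ), ‖u.toFun t‖ ^ 2) +
    (1 + ∫ t in Ici (0 : ℝ), ‖u.deriv t‖ ^ 2), fun x hx => ?_⟩
  have hx1 : (0 : ℝ) ≤ x + 1 := by linarith
  have hd := (u.intervalIntegrable_deriv hx hx1).norm
  have hu : IntervalIntegrable (fun t => ‖u.toFun t‖) volume x (x + 1) := by
    refine (ContinuousOn.intervalIntegrable ?_).norm
    refine u.continuousOn.mono fun t ht => ?_
    rw [uIcc_of_le (by linarith)] at ht
    exact hx.trans ht.1
  have hpt : ∀ y ∈ Icc x (x + 1),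
      ‖u.toFun x‖ ≤ ‖u.toFun y‖ + ∫ t in x..(x + 1), ‖u.deriv t‖ := by
    intro y hy
    have hy0 : 0 ≤ y := hx.trans hy.1
    have h1 : u.toFun y - u.toFun x = ∫ t in x..y, u.deriv t := by
      rw [u.eq_add_integral y hy0, u.eq_add_integral x hx,
        ← intervalIntegral.integral_interval_sub_left (u.intervalIntegrable_deriv le_rfl hy0)
          (u.intervalIntegrable_deriv le_rfl hx)]
      ring
    have h2 : ‖∫ t in x..y, u.deriv t‖ ≤ ∫ t in x..(x + 1), ‖u.deriv t‖ :=
      (intervalIntegral.norm_integral_le_integral_norm hy.1).trans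
        (intervalIntegral.integral_mono_interval le_rfl hy.1 hy.2
          (ae_of_all _ fun t => norm_nonneg _) hd)
    calc ‖u.toFun x‖ = ‖u.toFun y - (u.toFun y - u.toFun x)‖ := by congr 1; ring
      _ ≤ ‖u.toFun y‖ + ‖u.toFun y - u.toFun x‖ := norm_sub_le _ _
      _ ≤ _ := by rw [h1]; gcongr
  calc ‖u.toFun x‖ = ∫ _ in x..(x + 1), ‖u.toFun x‖ := by simp
    _ ≤ ∫ y in x..(x + 1), (‖u.toFun y‖ + ∫ t in x..(x + 1), ‖u.deriv t‖) :=
        intervalIntegral.integral_mono_on (by linarith) (by simp) (hu.add (by simp)) hpt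
    _ = (∫ y in x..(x + 1), ‖u.toFun y‖) + ∫ t in x..(x + 1), ‖u.deriv t‖ := by
        rw [intervalIntegral.integral_add hu (by simp)]; simp
    _ ≤ _ := add_le_add (key u.memLp x hx) (key u.memLp_deriv x hx)

lemma integrable_mul_conj (u v : HalfLineH1) (m : Measure ℝ≥0) [IsFiniteMeasure m] :
    Integrable (fun x : ℝ≥0 => u.toFun x * conj (v.toFun x)) m := by
  obtain ⟨C, hC⟩ := u.exists_bound
  obtain ⟨D, hD⟩ := v.exists_bound
  refine Integrable.of_bound (C := C * D) ?_ (ae_of_all _ fun x => ?_)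
  · exact (u.continuous_comp_coe.mul
      (Complex.continuous_conj.comp v.continuous_comp_coe)).aestronglyMeasurable
  · rw [norm_mul, RCLike.norm_conj]
    exact mul_le_mul (hC x x.2) (hD x x.2) (norm_nonneg _) ((norm_nonneg _).trans (hC x x.2))

/-- The integral against a signed measure is the difference of the integrals against its positive
and negative parts. -/
lemma signed_integral_eq (μ : SignedMeasure ℝ≥0) (f : ℝ≥0 → ℂ)
    (hf : ∀ (m : Measure ℝ≥0) [IsFiniteMeasure m], Integrable f m) :
    ∫ᵛ x, f x ∂<•μ = (∫ x, f x ∂μ.toJordanDecomposition.posPart) -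
      ∫ x, f x ∂μ.toJordanDecomposition.negPart := by
  conv_lhs => rw [← μ.toSignedMeasure_toJordanDecomposition, JordanDecomposition.toSignedMeasure]
  rw [VectorMeasure.integral_sub_vectorMeasure, VectorMeasure.integral_toSignedMeasure,
    VectorMeasure.integral_toSignedMeasure]
  · rw [VectorMeasure.Integrable, Measure.variation_toSignedMeasure]; exact hf _
  · rw [VectorMeasure.Integrable, Measure.variation_toSignedMeasure]; exact hf _

lemma integrable_deriv_mul_conj (u v : HalfLineH1) :
    Integrable (fun x => u.deriv x * conj (v.deriv x)) halfLineVolume :=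
  u.memLp_deriv.integrable_mul (v.memLp_deriv.star)

lemma form_zero_left (α : ℝ) (μ : SignedMeasure ℝ≥0) (v : HalfLineH1) : form α μ 0 v = 0 := by
  simp [form, freeForm, zero_toFun, zero_deriv]

lemma form_add_left (α : ℝ) (μ : SignedMeasure ℝ≥0) (u u' v : HalfLineH1) :
    form α μ (u + u') v = form α μ u v + form α μ u' v := by
  have h : freeForm α (u + u') v = freeForm α u v + freeForm α u' v := by
    simp only [freeForm, add_toFun, add_deriv, add_mul]
    rw [integral_add (u.integrable_deriv_mul_conj v) (u'.integrable_deriv_mul_conj v)]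
    split_ifs <;> ring
  rw [form, form, form, h]
  rw [signed_integral_eq μ _ (fun m _ => (u + u').integrable_mul_conj v m),
    signed_integral_eq μ _ (fun m _ => u.integrable_mul_conj v m),
    signed_integral_eq μ _ (fun m _ => u'.integrable_mul_conj v m)]
  simp only [add_toFun, add_mul]
  rw [integral_add (u.integrable_mul_conj v _) (u'.integrable_mul_conj v _),
    integral_add (u.integrable_mul_conj v _) (u'.integrable_mul_conj v _)]
  ring

lemma form_smul_left (α : ℝ) (μ : SignedMeasure ℝ≥0) (c : ℂ) (u v : HalfLineH1) :
    form α μ (c • u) v = c * form α μ u v := by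
  have h : freeForm α (c • u) v = c * freeForm α u v := by
    simp only [freeForm, smul_toFun, smul_deriv, mul_assoc]
    rw [integral_const_mul]
    split_ifs <;> ring
  rw [form, form, h]
  rw [signed_integral_eq μ _ (fun m _ => (c • u).integrable_mul_conj v m),
    signed_integral_eq μ _ (fun m _ => u.integrable_mul_conj v m)]
  simp only [smul_toFun, mul_assoc]
  rw [integral_const_mul, integral_const_mul]
  ring

end HalfLineH1

/-- The graph of the operator `A = -Δ_α + μ` associated to the form `a = a_α^μ` in the sense of
Kato's first representation theorem: `(f, h)` belongs to it iff `f ∈ D(a)` and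
`a(f, g) = ⟨h, g⟩` for all `g ∈ D(a)`; here `⟨h, g⟩ = ∫ h ḡ`, which is `inner ℂ g h` in
Mathlib's convention. -/
noncomputable def schrodingerGraph (α : ℝ) (μ : SignedMeasure ℝ≥0) :
    Submodule ℂ (HalfLineL2 × HalfLineL2) where
  carrier := {p | ∃ u : HalfLineH1, u.InFormDomain α ∧ u.toL2 = p.1 ∧
    ∀ v : HalfLineH1, v.InFormDomain α → HalfLineH1.form α μ u v = inner ℂ v.toL2 p.2}
  zero_mem' := ⟨0, fun _ => rfl, HalfLineH1.toL2_zero, fun v _ => by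
    simp [HalfLineH1.form_zero_left]⟩
  add_mem' := by
    rintro p q ⟨u, hu, hup, h⟩ ⟨u', hu', hup', h'⟩
    refine ⟨u + u', fun h0 => ?_, ?_, fun v hv => ?_⟩
    · rw [HalfLineH1.add_toFun, hu h0, hu' h0, add_zero]
    · rw [HalfLineH1.toL2_add, hup, hup', Prod.fst_add]
    · rw [HalfLineH1.form_add_left, h v hv, h' v hv, Prod.snd_add, inner_add_right]
  smul_mem' := by
    rintro c p ⟨u, hu, hup, h⟩
    refine ⟨c • u, fun h0 => ?_, ?_, fun v hv => ?_⟩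
    · rw [HalfLineH1.smul_toFun, hu h0, mul_zero]
    · rw [HalfLineH1.toL2_smul, hup, Prod.smul_fst]
    · rw [HalfLineH1.form_smul_left, h v hv, Prod.smul_snd, inner_smul_right]

/-- A test function on `(0, ∞)`, as an element of `H¹([0, ∞))`. -/
noncomputable def HalfLineH1.ofTest (φ : ℝ → ℝ) (hφ : ContDiff ℝ ∞ φ) (hc : HasCompactSupport φ) :
    HalfLineH1 where
  toFun x := (φ x : ℂ)
  deriv x := ((_root_.deriv φ x : ℝ) : ℂ)
  memLp := ((hφ.continuous.memLp_of_hasCompactSupport hc).restrict _).ofReal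
  memLp_deriv :=
    (((hφ.continuous_deriv (by simp)).memLp_of_hasCompactSupport hc.deriv).restrict _).ofReal
  eq_add_integral := fun x _ => by
    rw [intervalIntegral.integral_ofReal, intervalIntegral.integral_deriv_eq_sub
      (fun y _ => (hφ.differentiable (by simp)) y)
      ((hφ.continuous_deriv (by simp)).intervalIntegrable _ _)]
    push_cast
    ring

/-- The form domain is dense in `L²([0, ∞))`. -/
lemma eq_zero_of_inner_formDomain (α : ℝ) (h : HalfLineL2)
    (hh : ∀ v : HalfLineH1, v.InFormDomain α → inner ℂ v.toL2 h = 0) : h = 0 := by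
  have hmem := Lp.memLp h
  have hloc : LocallyIntegrableOn h (Ioi (0 : ℝ)) := by
    have := locallyIntegrableOn_of_locallyIntegrable_restrict
      (hmem.locallyIntegrable (by norm_num))
    exact this.mono_set Ioi_subset_Ici_self
  have h0 := isOpen_Ioi.ae_eq_zero_of_integral_contDiff_smul_eq_zero hloc (fun φ hφ hc hs => by
    have h1 := hh (HalfLineH1.ofTest φ hφ hc) (fun _ => by
      have : (0 : ℝ) ∉ tsupport φ := fun h0 => lt_irrefl (0 : ℝ) (hs h0)
      simp [HalfLineH1.ofTest, image_eq_zero_of_notMem_tsupport this])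
    rw [L2.inner_def] at h1
    have h2 : ∫ x in Ici (0 : ℝ), φ x • h x = 0 := by
      rw [← h1]
      refine integral_congr_ae ?_
      filter_upwards [(HalfLineH1.ofTest φ hφ hc).memLp.coeFn_toLp] with x hx
      rw [HalfLineH1.toL2, hx]
      simp [HalfLineH1.ofTest, mul_comm]
    rw [← h2, setIntegral_eq_integral_of_forall_compl_eq_zero]
    intro x hx
    have : x ∉ tsupport φ := fun h => hx (Ioi_subset_Ici_self (hs h))
    simp [image_eq_zero_of_notMem_tsupport this])
  have h3 : ∀ᵐ x ∂(volume.restrict (Ici (0 : ℝ))), h x = 0 := by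
    rw [Measure.restrict_congr_set Ioi_ae_eq_Ici.symm, ae_restrict_iff' measurableSet_Ioi]
    exact h0
  exact (Lp.eq_zero_iff_ae_eq_zero).2 h3

/-- An `H¹` function that vanishes in `L²` vanishes on `[0, ∞)`. -/
lemma HalfLineH1.toFun_eq_zero (u : HalfLineH1) (hu : u.toL2 = 0) :
    ∀ x : ℝ, 0 ≤ x → u.toFun x = 0 := by
  have h1 : u.toFun =ᵐ[halfLineVolume] fun _ => 0 := by
    have := u.memLp.coeFn_toLp
    rw [← HalfLineH1.toL2, hu] at this
    exact this.symm.trans (Lp.coeFn_zero _ _ _)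
  have h2 : EqOn u.toFun (fun _ => (0 : ℂ)) (Ici 0) := by
    refine Measure.eqOn_of_ae_eq h1 u.continuousOn continuousOn_const ?_
    rw [interior_Ici, closure_Ioi]
  exact fun x hx => h2 hx

/-- The weak derivative is the classical derivative almost everywhere. -/
lemma HalfLineH1.ae_hasDerivAt (u : HalfLineH1) :
    ∀ᵐ x ∂halfLineVolume, HasDerivAt u.toFun (u.deriv x) x := by
  have h : ∀ᵐ x : ℝ, ∀ n : ℕ, x ∈ uIcc (0 : ℝ) n → ∀ c ∈ uIcc (0 : ℝ) n,
      HasDerivAt (fun y => ∫ t in c..y, u.deriv t) (u.deriv x) x :=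
    ae_all_iff.2 fun n =>
      (u.intervalIntegrable_deriv le_rfl n.cast_nonneg).ae_hasDerivAt_integral
  rw [halfLineVolume, Measure.restrict_congr_set Ioi_ae_eq_Ici.symm,
    ae_restrict_iff' measurableSet_Ioi]
  filter_upwards [h] with x hx hx0
  have hx0 : (0 : ℝ) < x := hx0
  obtain ⟨n, hn⟩ := exists_nat_ge x
  have h1 := (hx n (by rw [uIcc_of_le n.cast_nonneg]; exact ⟨hx0.le, hn⟩) 0
    left_mem_uIcc).const_add (u.toFun 0)
  refine h1.congr_of_eventuallyEq ?_
  filter_upwards [Ioi_mem_nhds hx0] with y hy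
  exact u.eq_add_integral y (le_of_lt hy)

lemma HalfLineH1.deriv_ae_eq_zero (u : HalfLineH1) (hu : u.toL2 = 0) :
    ∀ᵐ x ∂halfLineVolume, u.deriv x = 0 := by
  have h := u.ae_hasDerivAt
  rw [halfLineVolume, Measure.restrict_congr_set Ioi_ae_eq_Ici.symm,
    ae_restrict_iff' measurableSet_Ioi] at h ⊢
  filter_upwards [h] with x hx hx0
  refine (hx hx0).unique ((hasDerivAt_const x (0 : ℂ)).congr_of_eventuallyEq ?_)
  filter_upwards [Ioi_mem_nhds hx0] with y hy
  exact u.toFun_eq_zero hu y (le_of_lt hy)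

/-- `schrodingerGraph α μ` is the graph of a (single-valued) operator. -/
lemma schrodingerGraph_snd_eq_zero (α : ℝ) (μ : SignedMeasure ℝ≥0)
    (p : HalfLineL2 × HalfLineL2) (hp : p ∈ schrodingerGraph α μ) (hp0 : p.1 = 0) : p.2 = 0 := by
  obtain ⟨u, hu, hup, h⟩ := hp
  rw [hp0] at hup
  refine eq_zero_of_inner_formDomain α p.2 fun v hv => ?_
  rw [← h v hv, HalfLineH1.form, HalfLineH1.freeForm, u.toFun_eq_zero hup 0 le_rfl]
  have h1 : ∫ x in Ici (0 : ℝ), u.deriv x * conj (v.deriv x) = 0 := by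
    refine integral_eq_zero_of_ae ?_
    filter_upwards [u.deriv_ae_eq_zero hup] with x hx
    simp [hx]
  have h2 : (fun x : ℝ≥0 => u.toFun x * conj (v.toFun x)) = fun _ => 0 := by
    funext x
    rw [u.toFun_eq_zero hup x x.2, zero_mul]
  rw [h1, h2]
  simp

/-- The Schrödinger operator `-Δ_α + μ` in `L²([0, ∞))`, as an unbounded operator: the operator
with graph `schrodingerGraph α μ`. -/
noncomputable def schrodingerOperator (α : ℝ) (μ : SignedMeasure ℝ≥0) :
    HalfLineL2 →ₗ.[ℂ] HalfLineL2 :=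
  (schrodingerGraph α μ).toLinearPMap

lemma schrodingerOperator_graph (α : ℝ) (μ : SignedMeasure ℝ≥0) :
    (schrodingerOperator α μ).graph = schrodingerGraph α μ :=
  Submodule.toLinearPMap_graph_eq _ (schrodingerGraph_snd_eq_zero α μ)

/-- The bounded operator `R` is the resolvent `(A - z)⁻¹` of the unbounded operator `A` at `z`:
it is a two-sided inverse of `A - z : D(A) → H`. -/
def IsResolventAt {H : Type*} [NormedAddCommGroup H] [InnerProductSpace ℂ H]
    (A : H →ₗ.[ℂ] H) (z : ℂ) (R : H →L[ℂ] H) : Prop :=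
  (∀ f : H, ∃ h : R f ∈ A.domain, A ⟨R f, h⟩ - z • R f = f) ∧
    ∀ f : A.domain, R (A f - z • (f : H)) = f

/-- Convergence in norm resolvent sense: for every nonreal `z` the resolvents
`(A n - z)⁻¹` and `(A - z)⁻¹` exist as bounded operators, and `(A n - z)⁻¹ → (A - z)⁻¹` in
operator norm. -/
def NormResolventConverges {H : Type*} [NormedAddCommGroup H] [InnerProductSpace ℂ H]
    (A : ℕ → H →ₗ.[ℂ] H) (B : H →ₗ.[ℂ] H) : Prop :=
  ∀ z : ℂ, z.im ≠ 0 → ∃ (R : ℕ → H →L[ℂ] H) (S : H →L[ℂ] H),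
    (∀ n, IsResolventAt (A n) z (R n)) ∧ IsResolventAt B z S ∧
      Tendsto (fun n => ‖R n - S‖) atTop (𝓝 0)

/-- Weak convergence of finite signed measures on `[0, ∞)`: convergence of the integrals of all
bounded continuous functions. -/
def SignedWeakConverges (μs : ℕ → SignedMeasure ℝ≥0) (μ : SignedMeasure ℝ≥0) : Prop :=
  ∀ f : ℝ≥0 →ᵇ ℝ,
    Tendsto (fun n => ∫ᵛ x, f x ∂<•(μs n)) atTop (𝓝 (∫ᵛ x, f x ∂<•μ))

/-! Let V be the form domain with the H¹ inner product, a Hilbert space, and J : V → L² the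
embedding. Each form is bounded and symmetric on V, hence represented by a bounded symmetric
operator A on V, and -Δ_α + μ is the set of pairs (Ju, h) with A u = J* h. So its resolvent at z is
J (A - z J*J)⁻¹ J*. The inverse exists for nonreal z: the imaginary part of the shifted form
controls ‖Ju‖², and the form is coercive up to a multiple of ‖Ju‖² (`exists_le_re_form`, from a
Sobolev inequality with a small constant). Self-adjointness follows from symmetry and these
resolvents. Since inversion is continuous at units, norm resolvent convergence reduces to norm
convergence of the operators A on V, i.e. to ∫ u v̄ d(μ_n - μ) → 0 uniformly for u, v in the unit
ball of V (`tendsto_operator`).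

The products u v̄ are then uniformly bounded and uniformly Hölder of exponent 1/2, but on a
noncompact half-line they do not form a precompact set in the sup norm. The substitute is a Schur
property (`eventually_norm_le_of_tendsto_boundedSeq`). Sampling at the points k/r and interpolating
linearly approximates all these products uniformly and factors through bounded sequences. On those,
functionals given by measures are continuous for coordinatewise convergence on the unit ball, and
Baire's theorem upgrades pointwise convergence to norm convergence. Banach–Steinhaus bounds the
functionals μ_n - μ, which controls the interpolation error. -/

/-! ### Operators associated with bounded forms on a form domain -/

section FormOperator

variable {V H : Type*} [NormedAddCommGroup V] [InnerProductSpace ℂ V] [CompleteSpace V]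
  [NormedAddCommGroup H] [InnerProductSpace ℂ H] [CompleteSpace H]

open ContinuousLinearMap (adjoint)

/-- Lax–Milgram for a symmetric form that is coercive up to a multiple of the norm of `H`, shifted
by a nonreal number. -/
lemma isUnit_sub_smul_adjoint_comp {J : V →L[ℂ] H} {A : V →L[ℂ] V}
    (hA : ∀ u v, inner ℂ (A u) v = inner ℂ u (A v)) {c C : ℝ} (hc : 0 < c)
    (hAc : ∀ u, c * ‖u‖ ^ 2 ≤ (inner ℂ (A u) u).re + C * ‖J u‖ ^ 2) {z : ℂ} (hz : z.im ≠ 0) :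
    IsUnit (A - z • (adjoint J ∘L J)) := by
  have hz' : 0 < |z.im| := abs_pos.2 hz
  -- With w the shifted form at u, the real part gives c‖u‖² ≤ |w| + (|C| + |Re z|)‖Ju‖², and ‖Ju‖²
  -- ≤ |w| / |Im z|; K collects the two contributions.
  set K : ℝ := 1 + (|C| + |z.re|) / |z.im| with hK
  have hK0 : 0 < K := by positivity
  refine ContinuousLinearMap.isUnit_of_forall_le_norm_inner_map _
    (c := ⟨c / K, (div_pos hc hK0).le⟩) (div_pos hc hK0) fun u => ?_
  have him : (inner ℂ (A u) u).im = 0 := by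
    have h : conj (inner ℂ (A u) u) = inner ℂ (A u) u := by
      rw [inner_conj_symm, hA]
    exact Complex.conj_eq_iff_im.1 h
  have hin : inner ℂ ((A - z • (adjoint J ∘L J)) u) u =
      inner ℂ (A u) u - conj z * ((‖J u‖ ^ 2 : ℝ) : ℂ) := by
    have h : inner ℂ (adjoint J (J u)) u = ((‖J u‖ ^ 2 : ℝ) : ℂ) := by
      rw [ContinuousLinearMap.adjoint_inner_left, inner_self_eq_norm_sq_to_K]
      norm_cast
    simp only [sub_apply, smul_apply,
      ContinuousLinearMap.comp_apply, inner_sub_left, inner_smul_left, h]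
  set w := inner ℂ ((A - z • (adjoint J ∘L J)) u) u with hw
  have hre : (inner ℂ (A u) u).re = w.re + z.re * ‖J u‖ ^ 2 := by
    rw [hin]
    simp only [Complex.sub_re, Complex.re_mul_ofReal, Complex.conj_re]
    ring
  have hwim : w.im = z.im * ‖J u‖ ^ 2 := by
    rw [hin]
    simp only [Complex.sub_im, Complex.im_mul_ofReal, Complex.conj_im, him]
    ring
  -- The unshifted form is real on the diagonal, so Im w comes from the shift alone. This works for
  -- every C, however z lies relative to the spectrum's lower bound.
  have hJ : ‖J u‖ ^ 2 ≤ ‖w‖ / |z.im| := by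
    rw [le_div_iff₀ hz', ← abs_of_nonneg (sq_nonneg ‖J u‖), ← abs_mul, mul_comm, ← hwim]
    exact Complex.abs_im_le_norm w
  have h1 := hAc u
  rw [hre] at h1
  have h2 : w.re ≤ ‖w‖ := Complex.re_le_norm w
  have h3 : (z.re + C) * ‖J u‖ ^ 2 ≤ (|C| + |z.re|) * (‖w‖ / |z.im|) := by
    refine mul_le_mul (by linarith [le_abs_self C, le_abs_self z.re]) hJ (sq_nonneg _)
      (by positivity)
  have h4 : c * ‖u‖ ^ 2 ≤ K * ‖w‖ := by
    calc c * ‖u‖ ^ 2 ≤ ‖w‖ + (|C| + |z.re|) * (‖w‖ / |z.im|) := by linarith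
      _ = K * ‖w‖ := by rw [hK]; ring
  change ‖u‖ ^ 2 * (c / K) ≤ ‖w‖
  rw [← mul_div_assoc, div_le_iff₀ hK0]
  linarith

/-- The resolvent at `z` of the operator associated with the form `⟨u, A v⟩`. -/
noncomputable def formResolvent (J : V →L[ℂ] H) (A : V →L[ℂ] V) (z : ℂ) : H →L[ℂ] H :=
  J ∘L Ring.inverse (A - z • (adjoint J ∘L J)) ∘L adjoint J

/-- With x = Ju, the equation (B - z) x = f reads A u = J*(f + z J u), that is (A - z J*J) u = J* f.
-/
lemma isResolventAt_formResolvent {J : V →L[ℂ] H} {A : V →L[ℂ] V} {B : H →ₗ.[ℂ] H}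
    (hB : ∀ x y, (x, y) ∈ B.graph ↔ ∃ u, J u = x ∧ A u = adjoint J y) {z : ℂ}
    (hT : IsUnit (A - z • (adjoint J ∘L J))) : IsResolventAt B z (formResolvent J A z) := by
  set T := A - z • (adjoint J ∘L J) with hTdef
  have hTapp : ∀ u, T u = A u - z • adjoint J (J u) := fun u => rfl
  have hr : ∀ v, T (Ring.inverse T v) = v := fun v =>
    DFunLike.congr_fun (Ring.mul_inverse_cancel T hT) v
  have hl : ∀ v, Ring.inverse T (T v) = v := fun v =>
    DFunLike.congr_fun (Ring.inverse_mul_cancel T hT) v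
  have happ : ∀ f, formResolvent J A z f = J (Ring.inverse T (adjoint J f)) := fun f => rfl
  constructor
  · intro f
    have hg : (formResolvent J A z f, f + z • formResolvent J A z f) ∈ B.graph := by
      refine (hB _ _).2 ⟨Ring.inverse T (adjoint J f), rfl, ?_⟩
      have := hr (adjoint J f)
      rw [hTapp, sub_eq_iff_eq_add] at this
      rw [this, map_add, map_smul, happ]
    obtain ⟨y, hy1, hy2⟩ := (LinearPMap.mem_graph_iff _).1 hg
    simp only at hy1 hy2
    refine ⟨hy1 ▸ y.2, ?_⟩
    have : (⟨formResolvent J A z f, hy1 ▸ y.2⟩ : B.domain) = y := Subtype.ext hy1.symm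
    rw [this, hy2]
    abel
  · intro f
    obtain ⟨u, hu1, hu2⟩ := (hB _ _).1 (LinearPMap.mem_graph B f)
    rw [happ, map_sub, map_smul, ← hu2, ← hu1, ← hTapp, hl]

/-- A symmetric operator all of whose nonreal shifts are invertible is self-adjoint. -/
lemma isSelfAdjoint_of_isResolventAt {B : H →ₗ.[ℂ] H}
    (hsym : ∀ p ∈ B.graph, ∀ q ∈ B.graph, inner ℂ p.2 q.1 = inner ℂ p.1 q.2)
    (hres : ∀ z : ℂ, z.im ≠ 0 → ∃ R, IsResolventAt B z R) : IsSelfAdjoint B := by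
  have hsurj : ∀ z : ℂ, z.im ≠ 0 → ∀ f, ∃ p ∈ B.graph, p.2 - z • p.1 = f := by
    intro z hz f
    obtain ⟨R, hR, -⟩ := hres z hz
    obtain ⟨h, hh⟩ := hR f
    exact ⟨_, B.mem_graph ⟨R f, h⟩, hh⟩
  -- B + i is onto, so only 0 is orthogonal to its range.
  have hzero : ∀ w, (∀ p ∈ B.graph, inner ℂ (p.2 + Complex.I • p.1) w = 0) → w = 0 := by
    intro w hw
    obtain ⟨p, hp, hpw⟩ := hsurj (-Complex.I) (by simp) w
    have := hw p hp
    rw [neg_smul, sub_neg_eq_add] at hpw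
    rwa [hpw, inner_self_eq_zero] at this
  have hI : ∀ a w : H, inner ℂ a (Complex.I • w) = -inner ℂ (Complex.I • a) w := by
    intro a w
    rw [inner_smul_left, inner_smul_right, Complex.conj_I]
    ring
  -- Density is not assumed. If w = (B - i) q is orthogonal to the domain, symmetry makes q
  -- orthogonal to the range of B + i, so q = 0 and w = 0.
  have hdense : Dense (B.domain : Set H) := by
    rw [Submodule.dense_iff_topologicalClosure_eq_top,
      Submodule.topologicalClosure_eq_top_iff, Submodule.eq_bot_iff]
    intro w hw
    rw [Submodule.mem_orthogonal] at hw
    obtain ⟨q, hq, hqw⟩ := hsurj Complex.I (by simp) w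
    have hq1 : q.1 = 0 := by
      refine hzero _ fun p hp => ?_
      have h1 := hw p.1 (by
        obtain ⟨y, hy, -⟩ := (LinearPMap.mem_graph_iff _).1 hp
        exact hy ▸ y.2)
      rw [← hqw, inner_sub_right, hI, ← hsym p hp q hq, sub_neg_eq_add] at h1
      rw [inner_add_left, h1]
    have hq2 : q.2 = 0 := B.graph_fst_eq_zero_snd hq hq1
    rw [← hqw, hq1, hq2, smul_zero, sub_zero]
  rw [LinearPMap.isSelfAdjoint_def]
  refine LinearPMap.eq_of_eq_graph ?_
  rw [LinearPMap.adjoint_graph_eq_graph_adjoint hdense]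
  ext x
  rw [Submodule.mem_adjoint_iff]
  constructor
  · intro hx
    -- The element q of the graph of B has the same image under the shift by i as x does. The
    -- difference of first components lies in the kernel of B* - i, which is orthogonal to the range
    -- of B + i.
    obtain ⟨q, hq, hqx⟩ := hsurj Complex.I (by simp) (x.2 - Complex.I • x.1)
    have hw : x.1 - q.1 = 0 := by
      refine hzero _ fun p hp => ?_
      have h1 := sub_eq_zero.1 (hx p.1 p.2 hp)
      have h2 := hsym p hp q hq
      have h3 : x.2 - q.2 = Complex.I • (x.1 - q.1) := by
        rw [smul_sub, sub_eq_sub_iff_sub_eq_sub, ← hqx]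
      have h4 : inner ℂ p.2 (x.1 - q.1) = inner ℂ p.1 (x.2 - q.2) := by
        rw [inner_sub_right, inner_sub_right, h1, h2]
      rw [inner_add_left, h4, h3, hI, neg_add_cancel]
    have h1 : x.1 = q.1 := sub_eq_zero.1 hw
    have h2 : x.2 = q.2 := by
      rw [h1] at hqx
      exact (sub_left_injective hqx).symm
    rwa [show x = q from Prod.ext h1 h2]
  · intro hx a b hab
    exact sub_eq_zero.2 (hsym _ hab _ hx)

lemma isSelfAdjoint_of_form {J : V →L[ℂ] H} {A : V →L[ℂ] V} {B : H →ₗ.[ℂ] H}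
    (hA : ∀ u v, inner ℂ (A u) v = inner ℂ u (A v)) {c C : ℝ} (hc : 0 < c)
    (hAc : ∀ u, c * ‖u‖ ^ 2 ≤ (inner ℂ (A u) u).re + C * ‖J u‖ ^ 2)
    (hB : ∀ x y, (x, y) ∈ B.graph ↔ ∃ u, J u = x ∧ A u = adjoint J y) : IsSelfAdjoint B := by
  refine isSelfAdjoint_of_isResolventAt ?_ fun z hz =>
    ⟨_, isResolventAt_formResolvent hB (isUnit_sub_smul_adjoint_comp hA hc hAc hz)⟩
  rintro ⟨x, y⟩ hp ⟨x', y'⟩ hq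
  obtain ⟨u, rfl, hu⟩ := (hB _ _).1 hp
  obtain ⟨v, rfl, hv⟩ := (hB _ _).1 hq
  simp only
  rw [← ContinuousLinearMap.adjoint_inner_left J, ← ContinuousLinearMap.adjoint_inner_right J,
    ← hu, ← hv, hA]

/-- Inversion in the Banach algebra of operators on V is continuous at units, so only the limit has
to be invertible. -/
lemma tendsto_formResolvent (J : V →L[ℂ] H) {A : ℕ → V →L[ℂ] V} {A' : V →L[ℂ] V} {z : ℂ}
    (hT : IsUnit (A' - z • (adjoint J ∘L J))) (hlim : Tendsto A atTop (𝓝 A')) :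
    Tendsto (fun n => ‖formResolvent J (A n) z - formResolvent J A' z‖) atTop (𝓝 0) := by
  rw [← tendsto_iff_norm_sub_tendsto_zero]
  obtain ⟨T, hT⟩ := hT
  have h1 : Tendsto (fun n => Ring.inverse (A n - z • (adjoint J ∘L J))) atTop
      (𝓝 (Ring.inverse (A' - z • (adjoint J ∘L J)))) := by
    have := NormedRing.inverse_continuousAt T
    rw [ContinuousAt, hT] at this
    exact this.comp (hlim.sub_const _)
  have h2 : Continuous fun S : V →L[ℂ] V => J ∘L S ∘L adjoint J := by fun_prop
  exact (h2.tendsto _).comp h1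

/-- Convergence of sesquilinear forms, uniformly on bounded sets, is norm convergence of the
operators that represent them. -/
lemma tendsto_of_forall_norm_inner_sub_le {E : Type*} [NormedAddCommGroup E]
    [InnerProductSpace ℂ E] {A : ℕ → E →L[ℂ] E} {A' : E →L[ℂ] E}
    (h : ∀ ε : ℝ, 0 < ε → ∀ᶠ n in atTop, ∀ u v,
      ‖inner ℂ v (A n u) - inner ℂ v (A' u)‖ ≤ ε * (‖u‖ * ‖v‖)) :
    Tendsto A atTop (𝓝 A') := by
  rw [Metric.tendsto_nhds]
  intro ε hε
  filter_upwards [h (ε / 2) (half_pos hε)] with n hn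
  rw [dist_eq_norm]
  refine lt_of_le_of_lt ?_ (half_lt_self hε)
  refine ContinuousLinearMap.opNorm_le_bound _ (half_pos hε).le fun u => ?_
  set v := (A n - A') u with hv
  have h1 := hn u v
  rw [← inner_sub_right, ← sub_apply, ← hv] at h1
  have h3 : ‖(inner ℂ v v : ℂ)‖ = ‖v‖ * ‖v‖ := by
    rw [← inner_self_re_eq_norm, inner_self_eq_norm_mul_norm]
  rw [h3] at h1
  rcases (norm_nonneg v).eq_or_lt with h2 | h2
  · rw [← h2]
    positivity
  · exact le_of_mul_le_mul_right (by linarith) h2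

end FormOperator

/-! ### A uniform form of the Schur property -/

/-- A sequence with values in the closed unit disc, as a bounded function. -/
noncomputable def boundedSeq (c : ℕ → Metric.closedBall (0 : ℂ) 1) : ℕ →ᵇ ℂ :=
  BoundedContinuousFunction.ofNormedAddCommGroupDiscrete (fun k => (c k : ℂ)) 1
    fun k => mem_closedBall_zero_iff.1 (c k).2

/-- Functionals on bounded sequences that are continuous for coordinatewise convergence on the unit
ball and tend to zero pointwise tend to zero in norm. -/
lemma eventually_norm_le_of_tendsto_boundedSeq (T : ℕ → (ℕ →ᵇ ℂ) →ₗ[ℂ] ℂ)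
    (hcont : ∀ n, Continuous fun c => T n (boundedSeq c))
    (hlim : ∀ c, Tendsto (fun n => T n c) atTop (𝓝 0)) {ε : ℝ} (hε : 0 < ε) :
    ∀ᶠ n in atTop, ∀ c : ℕ →ᵇ ℂ, ‖T n c‖ ≤ ε * ‖c‖ := by
  classical
  have hε2 : 0 < ε / 2 := half_pos hε
  -- Baire's theorem on the compact product of discs: these closed sets cover it, so one contains a
  -- basic open set, which restricts only the finitely many coordinates in I.
  let F : ℕ → Set (ℕ → Metric.closedBall (0 : ℂ) 1) := fun N =>
    ⋂ n ≥ N, {c | ‖T n (boundedSeq c)‖ ≤ ε / 2}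
  have hFc : ∀ N, IsClosed (F N) := fun N =>
    isClosed_biInter fun n _ => isClosed_le (hcont n).norm continuous_const
  have hFU : ⋃ N, F N = univ := by
    refine eq_univ_of_forall fun c => mem_iUnion.2 ?_
    have := (hlim (boundedSeq c)).norm
    rw [norm_zero] at this
    obtain ⟨N, hN⟩ := eventually_atTop.1 (this.eventually (Iic_mem_nhds hε2))
    exact ⟨N, mem_iInter₂.2 fun n hn => hN n hn⟩
  obtain ⟨N, a, ha⟩ := nonempty_interior_of_iUnion_of_closed hFc hFU
  obtain ⟨I, u, hu, hIu⟩ := isOpen_pi_iff.1 isOpen_interior a ha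
  let e : ℕ → ℕ →ᵇ ℂ := fun i => boundedSeq fun k =>
    if k = i then ⟨1, by simp⟩ else ⟨0, by simp⟩
  -- The factor 2 bounds |c i - a i| for two points of the unit disc.
  have he : ∀ᶠ n in atTop, ∑ i ∈ I, 2 * ‖T n (e i)‖ ≤ ε / 2 := by
    have : Tendsto (fun n => ∑ i ∈ I, 2 * ‖T n (e i)‖) atTop (𝓝 (∑ i ∈ I, 2 * ‖(0 : ℂ)‖)) :=
      tendsto_finsetSum _ fun i _ => ((hlim (e i)).norm).const_mul 2
    simp only [norm_zero, mul_zero, Finset.sum_const_zero] at this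
    exact this.eventually (Iic_mem_nhds hε2)
  filter_upwards [he, eventually_ge_atTop N] with n hn hnN c'
  refine (LinearMap.bound_of_ball_bound' one_pos ε (T n) (fun c hc => ?_) c').trans_eq
    (by rw [div_one])
  rw [mem_closedBall_zero_iff] at hc
  have hck : ∀ k, ‖c k‖ ≤ 1 := fun k => (c.norm_coe_le_norm k).trans hc
  -- Changing c to a on the coordinates in I lands in the basic open set; the error is a finite
  -- combination of unit sequences, on which T n tends to 0.
  let b : ℕ → Metric.closedBall (0 : ℂ) 1 := fun k =>
    if k ∈ I then a k else ⟨c k, mem_closedBall_zero_iff.2 (hck k)⟩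
  have hb : b ∈ F N := interior_subset (hIu fun i hi => by
    simp only [b, if_pos (Finset.mem_coe.1 hi)]
    exact (hu i hi).2)
  have hbn : ‖T n (boundedSeq b)‖ ≤ ε / 2 := mem_iInter₂.1 hb n hnN
  have hsum : c = boundedSeq b + ∑ i ∈ I, (c i - a i) • e i := by
    ext k
    have h1 : (∑ i ∈ I, (c i - a i) • e i) k = if k ∈ I then c k - a k else 0 := by
      rw [BoundedContinuousFunction.sum_apply]
      simp only [BoundedContinuousFunction.coe_smul]
      have : ∀ i, e i k = if k = i then (1 : ℂ) else 0 := fun i => by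
        change ((if k = i then ⟨1, by simp⟩ else ⟨0, by simp⟩ :
          Metric.closedBall (0 : ℂ) 1) : ℂ) = _
        split_ifs <;> rfl
      simp [this]
    rw [BoundedContinuousFunction.add_apply, h1]
    change c k = (b k : ℂ) + _
    by_cases hk : k ∈ I <;> simp [b, hk]
  rw [hsum, map_add, map_sum]
  calc _ ≤ ‖T n (boundedSeq b)‖ + ∑ i ∈ I, ‖T n ((c i - a i) • e i)‖ :=
        (norm_add_le _ _).trans (add_le_add le_rfl (norm_sum_le _ _))
    _ ≤ ε / 2 + ∑ i ∈ I, 2 * ‖T n (e i)‖ := by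
        refine add_le_add hbn (Finset.sum_le_sum fun i _ => ?_)
        rw [map_smul, norm_smul]
        refine mul_le_mul_of_nonneg_right ?_ (norm_nonneg _)
        have := mem_closedBall_zero_iff.1 (a i).2
        linarith [norm_sub_le (c i) (a i), hck i]
    _ ≤ ε := by linarith

/-! ### Piecewise linear functions on the half-line -/

lemma intervalIntegrable_comp_natFloor (c : ℕ →ᵇ ℂ) (a b : ℝ) :
    IntervalIntegrable (fun s => c ⌊s⌋₊) volume a b := by
  rw [intervalIntegrable_iff]
  refine Measure.integrableOn_of_bounded (M := ‖c‖) (by simp) ?_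
    (ae_of_all _ fun s => c.norm_coe_le_norm _)
  exact ((measurable_from_nat (f := c)).comp Nat.measurable_floor).aestronglyMeasurable

/-- The average over `[t, t + 1]`, `t = r x`, of the step function with values `c`: a continuous
piecewise linear function of `x`. -/
noncomputable def stepAverage (r : ℝ) : (ℕ →ᵇ ℂ) →ₗ[ℂ] (ℝ≥0 →ᵇ ℂ) where
  toFun c := BoundedContinuousFunction.ofNormedAddCommGroup
    (fun x : ℝ≥0 => ∫ s in (r * x : ℝ)..(r * x + 1), c ⌊s⌋₊)
    (by
      have h := intervalIntegral.continuous_primitive (intervalIntegrable_comp_natFloor c) 0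
      have h1 : (fun x : ℝ≥0 => ∫ s in (r * x : ℝ)..(r * x + 1), c ⌊s⌋₊) = fun x : ℝ≥0 =>
          (∫ s in (0 : ℝ)..(r * x + 1), c ⌊s⌋₊) - ∫ s in (0 : ℝ)..(r * x), c ⌊s⌋₊ := by
        funext x
        rw [intervalIntegral.integral_interval_sub_left] <;>
          exact intervalIntegrable_comp_natFloor c _ _
      rw [h1]
      fun_prop)
    ‖c‖
    (fun x => by
      refine (intervalIntegral.norm_integral_le_of_norm_le_const
        fun s _ => c.norm_coe_le_norm _).trans ?_
      simp)
  map_add' c d := by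
    ext x
    exact intervalIntegral.integral_add (intervalIntegrable_comp_natFloor c _ _)
      (intervalIntegrable_comp_natFloor d _ _)
  map_smul' a c := by
    ext x
    exact intervalIntegral.integral_smul a _

lemma stepAverage_apply (r : ℝ) (c : ℕ →ᵇ ℂ) (x : ℝ≥0) :
    stepAverage r c x = ∫ s in (r * x : ℝ)..(r * x + 1), c ⌊s⌋₊ := rfl

lemma norm_stepAverage_le (r : ℝ) (c : ℕ →ᵇ ℂ) : ‖stepAverage r c‖ ≤ ‖c‖ :=
  (BoundedContinuousFunction.norm_le (norm_nonneg _)).2 fun x =>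
    (intervalIntegral.norm_integral_le_of_norm_le_const
      fun s _ => c.norm_coe_le_norm _).trans (by simp)

/-- Sampling at the points `k / r` and averaging gives a uniform approximation. -/
lemma norm_sub_stepAverage_le {r : ℝ} (hr : 0 < r) {w : ℝ≥0 →ᵇ ℂ} {c : ℕ →ᵇ ℂ}
    (hc : ∀ k : ℕ, c k = w (Real.toNNReal (k / r))) {δ : ℝ} (hδ : 0 ≤ δ)
    (hw : ∀ x y : ℝ≥0, |(x : ℝ) - y| ≤ 1 / r → ‖w x - w y‖ ≤ δ) :
    ‖w - stepAverage r c‖ ≤ δ := by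
  rw [BoundedContinuousFunction.norm_le hδ]
  intro x
  -- The interval of averaging has length 1, so the constant w x is its own average. For s in it,
  -- the sampling point ⌊s⌋₊ / r is within 1 / r of x.
  have h1 : (w - stepAverage r c) x = ∫ s in (r * x : ℝ)..(r * x + 1), (w x - c ⌊s⌋₊) := by
    rw [BoundedContinuousFunction.sub_apply, stepAverage_apply, intervalIntegral.integral_sub
      (by simp) (intervalIntegrable_comp_natFloor c _ _)]
    simp
  rw [h1]
  refine (intervalIntegral.norm_integral_le_of_norm_le_const (C := δ) fun s hs => ?_).trans
    (by simp)
  rw [uIoc_of_le (by linarith)] at hs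
  have hrx : 0 ≤ r * x := mul_nonneg hr.le x.2
  have hs0 : 0 ≤ s := hrx.trans hs.1.le
  rw [hc]
  refine hw _ _ ?_
  rw [Real.coe_toNNReal _ (by positivity)]
  have e1 := Nat.floor_le hs0
  have e2 := Nat.lt_floor_add_one s
  have : (x : ℝ) - ⌊s⌋₊ / r = (r * x - ⌊s⌋₊) / r := by field_simp
  rw [this, abs_div, abs_of_pos hr]
  gcongr
  rw [abs_le]
  constructor <;> linarith [hs.1, hs.2]

/-- At each s the integrand involves a single coordinate and is bounded by 1, so dominated
convergence applies on the countable product. -/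
lemma continuous_stepAverage_boundedSeq (r : ℝ) (x : ℝ≥0) :
    Continuous fun c => stepAverage r (boundedSeq c) x := by
  simp only [stepAverage_apply]
  refine intervalIntegral.continuous_of_dominated_interval (bound := fun _ => 1) (fun c => ?_)
    (fun c => ae_of_all _ fun s _ => mem_closedBall_zero_iff.1 (c ⌊s⌋₊).2) (by simp)
    (ae_of_all _ fun s _ => ?_)
  · exact ((measurable_from_nat (f := boundedSeq c)).comp
      Nat.measurable_floor).aestronglyMeasurable
  · exact continuous_subtype_val.comp (continuous_apply _)

/-! ### Integration of bounded continuous functions against signed measures -/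

/-- Integration against a signed measure, as a functional on bounded continuous functions. -/
noncomputable def signedIntegral (μ : SignedMeasure ℝ≥0) : (ℝ≥0 →ᵇ ℂ) →L[ℂ] ℂ :=
  LinearMap.mkContinuous
    { toFun := fun f => (∫ x, f x ∂μ.toJordanDecomposition.posPart) -
        ∫ x, f x ∂μ.toJordanDecomposition.negPart
      map_add' := fun f g => by
        simp only [BoundedContinuousFunction.add_apply]
        rw [integral_add (f.integrable _) (g.integrable _),
          integral_add (f.integrable _) (g.integrable _)]
        ring
      map_smul' := fun a f => by
        simp only [BoundedContinuousFunction.coe_smul, integral_smul, RingHom.id_apply, smul_sub] }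
    (μ.toJordanDecomposition.posPart.real univ + μ.toJordanDecomposition.negPart.real univ)
    (fun f => by
      have h : ∀ (m : Measure ℝ≥0) [IsFiniteMeasure m], ‖∫ x, f x ∂m‖ ≤ m.real univ * ‖f‖ :=
        fun m _ => (norm_integral_le_of_norm_le_const (ae_of_all _ f.norm_coe_le_norm)).trans
          (mul_comm _ _).le
      rw [add_mul]
      exact (norm_sub_le _ _).trans (add_le_add (h _) (h _)))

lemma signedIntegral_apply (μ : SignedMeasure ℝ≥0) (f : ℝ≥0 →ᵇ ℂ) :
    signedIntegral μ f = (∫ x, f x ∂μ.toJordanDecomposition.posPart) -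
        ∫ x, f x ∂μ.toJordanDecomposition.negPart := rfl

lemma integral_vectorMeasure_eq_signedIntegral (μ : SignedMeasure ℝ≥0) (f : ℝ≥0 →ᵇ ℂ) :
    ∫ᵛ x, f x ∂<•μ = signedIntegral μ f :=
  HalfLineH1.signed_integral_eq μ f fun _ _ => f.integrable _

lemma integral_vectorMeasure_eq_sub (μ : SignedMeasure ℝ≥0) (f : ℝ≥0 →ᵇ ℝ) :
    ∫ᵛ x, f x ∂<•μ = (∫ x, f x ∂μ.toJordanDecomposition.posPart) -
      ∫ x, f x ∂μ.toJordanDecomposition.negPart := by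
  conv_lhs => rw [← μ.toSignedMeasure_toJordanDecomposition, JordanDecomposition.toSignedMeasure]
  rw [VectorMeasure.integral_sub_vectorMeasure, VectorMeasure.integral_toSignedMeasure,
    VectorMeasure.integral_toSignedMeasure]
  · rw [VectorMeasure.Integrable, Measure.variation_toSignedMeasure]; exact f.integrable _
  · rw [VectorMeasure.Integrable, Measure.variation_toSignedMeasure]; exact f.integrable _

lemma SignedWeakConverges.tendsto_signedIntegral {μs : ℕ → SignedMeasure ℝ≥0}
    {μ : SignedMeasure ℝ≥0} (h : SignedWeakConverges μs μ) (f : ℝ≥0 →ᵇ ℂ) :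
    Tendsto (fun n => signedIntegral (μs n) f) atTop (𝓝 (signedIntegral μ f)) := by
  let fr : ℝ≥0 →ᵇ ℝ := BoundedContinuousFunction.ofNormedAddCommGroup (fun x => (f x).re)
    (by fun_prop) ‖f‖ fun x => (Complex.abs_re_le_norm _).trans (f.norm_coe_le_norm x)
  let fi : ℝ≥0 →ᵇ ℝ := BoundedContinuousFunction.ofNormedAddCommGroup (fun x => (f x).im)
    (by fun_prop) ‖f‖ fun x => (Complex.abs_im_le_norm _).trans (f.norm_coe_le_norm x)
  -- Weak convergence is stated for real test functions, hence the splitting into real and imaginary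
  -- parts.
  have key : ∀ ν : SignedMeasure ℝ≥0, signedIntegral ν f =
      ((∫ᵛ x, fr x ∂<•ν : ℝ) : ℂ) + ((∫ᵛ x, fi x ∂<•ν : ℝ) : ℂ) * Complex.I := by
    intro ν
    have hm : ∀ (m : Measure ℝ≥0) [IsFiniteMeasure m],
        ∫ x, f x ∂m = ((∫ x, fr x ∂m : ℝ) : ℂ) + ((∫ x, fi x ∂m : ℝ) : ℂ) * Complex.I :=
      fun m _ => (integral_re_add_im (𝕜 := ℂ) (f.integrable m)).symm
    rw [signedIntegral_apply, integral_vectorMeasure_eq_sub, integral_vectorMeasure_eq_sub,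
      hm, hm]
    push_cast
    ring
  simp only [key]
  exact ((Complex.continuous_ofReal.tendsto _).comp (h fr)).add
    (((Complex.continuous_ofReal.tendsto _).comp (h fi)).mul_const _)

/-- Dominated convergence against the two Jordan parts. Countable additivity is essential here: a
general functional on bounded continuous functions may charge infinity and fail this continuity. -/
lemma continuous_signedIntegral_stepAverage (μ : SignedMeasure ℝ≥0) (r : ℝ) :
    Continuous fun c => signedIntegral μ (stepAverage r (boundedSeq c)) := by
  have h : ∀ (m : Measure ℝ≥0) [IsFiniteMeasure m],
      Continuous fun c => ∫ x, stepAverage r (boundedSeq c) x ∂m := fun m _ => by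
    refine MeasureTheory.continuous_of_dominated (bound := fun _ => 1)
      (fun c => (stepAverage r (boundedSeq c)).continuous.aestronglyMeasurable)
      (fun c => ae_of_all _ fun x => ?_) (integrable_const _)
      (ae_of_all _ fun x => continuous_stepAverage_boundedSeq r x)
    refine ((stepAverage r (boundedSeq c)).norm_coe_le_norm x).trans
      ((norm_stepAverage_le r _).trans ?_)
    exact (BoundedContinuousFunction.norm_le zero_le_one).2
      fun k => mem_closedBall_zero_iff.1 (c k).2
  simp only [signedIntegral_apply]
  exact (h _).sub (h _)

/-- Weak convergence of signed measures is uniform on bounded uniformly equicontinuous sets. -/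
lemma SignedWeakConverges.exists_eventually_le {μs : ℕ → SignedMeasure ℝ≥0}
    {μ : SignedMeasure ℝ≥0} (h : SignedWeakConverges μs μ) : ∃ M : ℝ, 0 ≤ M ∧
      ∀ r : ℝ, 0 < r → ∀ ε : ℝ, 0 < ε → ∀ᶠ n in atTop, ∀ (w : ℝ≥0 →ᵇ ℂ) (δ : ℝ), 0 ≤ δ →
        (∀ x y : ℝ≥0, |(x : ℝ) - y| ≤ 1 / r → ‖w x - w y‖ ≤ δ) →
        ‖signedIntegral (μs n) w - signedIntegral μ w‖ ≤ M * δ + ε * ‖w‖ := by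
  set Λ : ℕ → (ℝ≥0 →ᵇ ℂ) →L[ℂ] ℂ := fun n => signedIntegral (μs n) - signedIntegral μ with hΛ
  have hlim : ∀ f, Tendsto (fun n => Λ n f) atTop (𝓝 0) := fun f => by
    have := (h.tendsto_signedIntegral f).sub_const (signedIntegral μ f)
    rwa [sub_self] at this
  -- M is fixed before r and ε, so the sampling step can later be chosen in terms of M.
  obtain ⟨M, hM⟩ := banach_steinhaus (g := Λ) fun f => by
    obtain ⟨C, hC⟩ := (hlim f).norm.bddAbove_range
    exact ⟨C, fun n => hC ⟨n, rfl⟩⟩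
  refine ⟨M, (norm_nonneg _).trans (hM 0), fun r hr ε hε => ?_⟩
  have hT := eventually_norm_le_of_tendsto_boundedSeq
    (fun n => (Λ n).toLinearMap ∘ₗ stepAverage r)
    (fun n => (continuous_signedIntegral_stepAverage (μs n) r).sub
      (continuous_signedIntegral_stepAverage μ r)) (fun c => hlim _) hε
  filter_upwards [hT] with n hn w δ hδ hwδ
  let c : ℕ →ᵇ ℂ := BoundedContinuousFunction.ofNormedAddCommGroupDiscrete
    (fun k => w (Real.toNNReal (k / r))) ‖w‖ fun k => w.norm_coe_le_norm _
  have hc : ‖c‖ ≤ ‖w‖ := (BoundedContinuousFunction.norm_le (norm_nonneg _)).2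
    fun k => w.norm_coe_le_norm _
  have h1 := norm_sub_stepAverage_le hr (c := c) (fun k => rfl) hδ hwδ
  calc ‖Λ n w‖ = ‖Λ n (w - stepAverage r c) + Λ n (stepAverage r c)‖ := by
        rw [← map_add, sub_add_cancel]
    _ ≤ ‖Λ n (w - stepAverage r c)‖ + ‖Λ n (stepAverage r c)‖ := norm_add_le _ _
    _ ≤ M * δ + ε * ‖w‖ := add_le_add (((Λ n).le_opNorm _).trans
        (mul_le_mul (hM n) h1 (norm_nonneg _) ((norm_nonneg _).trans (hM 0)))) 
        ((hn c).trans (mul_le_mul_of_nonneg_left hc hε.le))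

/-! ### Estimates for `H¹` functions -/

lemma Ioc_subset_Ici_zero {x : ℝ} (hx : 0 ≤ x) (y : ℝ) : Ioc x y ⊆ Ici (0 : ℝ) :=
  fun _ ht => hx.trans ht.1.le

lemma halfLineVolume_Ioc {x : ℝ} (hx : 0 ≤ x) (y : ℝ) :
    halfLineVolume (Ioc x y) = ENNReal.ofReal (y - x) := by
  rw [halfLineVolume, Measure.restrict_apply measurableSet_Ioc,
    inter_eq_self_of_subset_left (Ioc_subset_Ici_zero hx y), Real.volume_Ioc]

/-- As an inner product, the integral is visibly continuous in g, and Cauchy–Schwarz bounds it by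
the square root of the length. -/
lemma intervalIntegral_eq_inner_indicator (g : HalfLineL2) {x y : ℝ} (hx : 0 ≤ x) (hxy : x ≤ y) :
    ∫ t in x..y, g t = inner ℂ (indicatorConstLp 2 measurableSet_Ioc
      (halfLineVolume_Ioc hx y ▸ ENNReal.ofReal_ne_top) (1 : ℂ) : HalfLineL2) g := by
  rw [L2.inner_indicatorConstLp_one, intervalIntegral.integral_of_le hxy,
    Measure.restrict_restrict measurableSet_Ioc,
    inter_eq_self_of_subset_left (Ioc_subset_Ici_zero hx y)]

lemma continuous_intervalIntegral_halfLineL2 {x : ℝ} (hx : 0 ≤ x) :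
    Continuous fun g : HalfLineL2 => ∫ t in (0 : ℝ)..x, g t := by
  simp only [intervalIntegral_eq_inner_indicator _ le_rfl hx]
  fun_prop

lemma norm_intervalIntegral_halfLineL2_sq_le (g : HalfLineL2) {x y : ℝ} (hx : 0 ≤ x)
    (hxy : x ≤ y) : ‖∫ t in x..y, g t‖ ^ 2 ≤ (y - x) * ‖g‖ ^ 2 := by
  rw [intervalIntegral_eq_inner_indicator g hx hxy]
  refine (pow_le_pow_left₀ (norm_nonneg _) (norm_inner_le_norm _ _) 2).trans ?_
  rw [mul_pow]
  refine mul_le_mul_of_nonneg_right (le_of_eq ?_) (sq_nonneg _)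
  rw [norm_indicatorConstLp (by norm_num) (by norm_num), measureReal_def, halfLineVolume_Ioc hx,
    ENNReal.toReal_ofReal (sub_nonneg.2 hxy), norm_one, one_mul]
  rw [← Real.rpow_natCast, ← Real.rpow_mul (sub_nonneg.2 hxy)]
  norm_num

namespace HalfLineH1

/-- The weak derivative as an element of `L²([0, ∞))`. -/
noncomputable def derivL2 (u : HalfLineH1) : HalfLineL2 := u.memLp_deriv.toLp u.deriv

lemma intervalIntegral_deriv (u : HalfLineH1) {x y : ℝ} (hx : 0 ≤ x) (hxy : x ≤ y) :
    ∫ t in x..y, u.deriv t = ∫ t in x..y, u.derivL2 t := by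
  have h := u.memLp_deriv.coeFn_toLp
  rw [EventuallyEq, ae_restrict_iff' measurableSet_Ici] at h
  refine intervalIntegral.integral_congr_ae ?_
  filter_upwards [h] with t ht hxt
  rw [uIoc_of_le hxy] at hxt
  exact (ht (hx.trans hxt.1.le)).symm

/-- Hölder continuity of exponent 1/2, from Cauchy–Schwarz applied to the derivative. -/
lemma norm_sub_sq_le (u : HalfLineH1) {x y : ℝ} (hx : 0 ≤ x) (hy : 0 ≤ y) :
    ‖u.toFun x - u.toFun y‖ ^ 2 ≤ |x - y| * ‖u.derivL2‖ ^ 2 := by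
  wlog hxy : x ≤ y generalizing x y
  · rw [norm_sub_rev, abs_sub_comm]
    exact this hy hx (le_of_not_ge hxy)
  have h1 : u.toFun y - u.toFun x = ∫ t in x..y, u.derivL2 t := by
    rw [← u.intervalIntegral_deriv hx hxy, u.eq_add_integral y hy, u.eq_add_integral x hx,
      ← intervalIntegral.integral_interval_sub_left (u.intervalIntegrable_deriv le_rfl hy)
        (u.intervalIntegrable_deriv le_rfl hx)]
    ring
  rw [norm_sub_rev, h1, abs_sub_comm, abs_of_nonneg (sub_nonneg.2 hxy)]
  exact norm_intervalIntegral_halfLineL2_sq_le _ hx hxy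

lemma norm_toL2_sq (u : HalfLineH1) : ‖u.toL2‖ ^ 2 = ∫ x in Ici (0 : ℝ), ‖u.toFun x‖ ^ 2 := by
  have h : ((‖u.toL2‖ ^ 2 : ℝ) : ℂ) = inner ℂ u.toL2 u.toL2 := by
    rw [inner_self_eq_norm_sq_to_K]
    norm_cast
  rw [L2.inner_def] at h
  rw [← Complex.ofReal_inj, h, ← integral_complex_ofReal]
  refine integral_congr_ae ?_
  filter_upwards [u.memLp.coeFn_toLp] with x hx
  rw [toL2, hx, inner_self_eq_norm_sq_to_K]
  norm_cast

/-- The Sobolev inequality, with a small constant in front of the derivative. -/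
lemma norm_sq_le (u : HalfLineH1) {h : ℝ} (hh : 0 < h) {x : ℝ} (hx : 0 ≤ x) :
    ‖u.toFun x‖ ^ 2 ≤ 2 / h * ‖u.toL2‖ ^ 2 + 2 * h * ‖u.derivL2‖ ^ 2 := by
  have hi : IntegrableOn (fun x => ‖u.toFun x‖ ^ 2) (Ici (0 : ℝ)) :=
    u.memLp.integrable_norm_pow (p := 2) (by norm_num)
  have hsub := Ioc_subset_Ici_zero hx (x + h)
  -- For y in this interval, ‖u x‖² ≤ 2‖u y‖² + 2‖u x - u y‖² and the last term is at most 2h‖u'‖²;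
  -- integrate in y and divide by h.
  have h1 : ∫ _ in Ioc x (x + h), (‖u.toFun x‖ ^ 2 - 2 * h * ‖u.derivL2‖ ^ 2) ≤
      ∫ y in Ioc x (x + h), 2 * ‖u.toFun y‖ ^ 2 := by
    refine setIntegral_mono_on (by simp) ((hi.mono_set hsub).const_mul 2) measurableSet_Ioc
      fun y hy => ?_
    have e1 := u.norm_sub_sq_le hx (hsub hy)
    have e2 : |x - y| * ‖u.derivL2‖ ^ 2 ≤ h * ‖u.derivL2‖ ^ 2 := by
      refine mul_le_mul_of_nonneg_right ?_ (sq_nonneg _)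
      rw [abs_le]
      constructor <;> linarith [hy.1, hy.2]
    have e3 : ‖u.toFun x‖ ≤ ‖u.toFun y‖ + ‖u.toFun x - u.toFun y‖ := by
      simpa using norm_add_le (u.toFun y) (u.toFun x - u.toFun y)
    have e4 : ‖u.toFun x‖ ^ 2 ≤ 2 * ‖u.toFun y‖ ^ 2 + 2 * ‖u.toFun x - u.toFun y‖ ^ 2 := by
      refine (pow_le_pow_left₀ (norm_nonneg _) e3 2).trans ?_
      linarith [sq_nonneg (‖u.toFun y‖ - ‖u.toFun x - u.toFun y‖)]
    linarith
  rw [integral_const_mul] at h1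
  have h2 : ∫ y in Ioc x (x + h), ‖u.toFun y‖ ^ 2 ≤ ‖u.toL2‖ ^ 2 := by
    rw [norm_toL2_sq]
    exact setIntegral_mono_set hi (ae_of_all _ fun t => sq_nonneg _) hsub.eventuallyLE
  have h3 : ∫ _ in Ioc x (x + h), (‖u.toFun x‖ ^ 2 - 2 * h * ‖u.derivL2‖ ^ 2) =
      h * (‖u.toFun x‖ ^ 2 - 2 * h * ‖u.derivL2‖ ^ 2) := by
    simp [hh.le]
  rw [h3] at h1
  have h4 : ‖u.toFun x‖ ^ 2 - 2 * h * ‖u.derivL2‖ ^ 2 ≤ 2 * ‖u.toL2‖ ^ 2 / h := by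
    rw [le_div_iff₀ hh]
    linarith
  linarith [show 2 / h * ‖u.toL2‖ ^ 2 = 2 * ‖u.toL2‖ ^ 2 / h by ring]

/-! ### The form domain as a Hilbert space -/

/-- An `H¹` function together with its derivative, as an element of `L² × L²`. -/
noncomputable def pair (u : HalfLineH1) : WithLp 2 (HalfLineL2 × HalfLineL2) :=
  WithLp.toLp 2 (u.toL2, u.derivL2)

lemma norm_pair_sq (u : HalfLineH1) : ‖u.pair‖ ^ 2 = ‖u.toL2‖ ^ 2 + ‖u.derivL2‖ ^ 2 :=
  WithLp.prod_norm_sq_eq_of_L2 _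

lemma norm_derivL2_le (u : HalfLineH1) : ‖u.derivL2‖ ≤ ‖u.pair‖ :=
  le_of_sq_le_sq (by rw [norm_pair_sq]; linarith [sq_nonneg ‖u.toL2‖]) (norm_nonneg _)

lemma norm_le_two_mul_norm_pair (u : HalfLineH1) {x : ℝ} (hx : 0 ≤ x) :
    ‖u.toFun x‖ ≤ 2 * ‖u.pair‖ := by
  refine le_of_sq_le_sq ?_ (by positivity)
  have h1 := u.norm_sq_le one_pos hx
  have h2 := u.norm_pair_sq
  nlinarith [sq_nonneg ‖u.pair‖]

lemma pair_zero : (0 : HalfLineH1).pair = 0 := by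
  rw [pair, toL2_zero, show (0 : HalfLineH1).derivL2 = 0 from MemLp.toLp_zero _]
  rfl

lemma pair_add (u v : HalfLineH1) : (u + v).pair = u.pair + v.pair := by
  rw [pair, toL2_add, show (u + v).derivL2 = u.derivL2 + v.derivL2 from MemLp.toLp_add _ _]
  rfl

lemma pair_smul (c : ℂ) (u : HalfLineH1) : (c • u).pair = c • u.pair := by
  rw [pair, toL2_smul, show (c • u).derivL2 = c • u.derivL2 from
    MemLp.toLp_const_smul c u.memLp_deriv]
  rfl

end HalfLineH1

/-- The form domain, as a subspace of `L² × L²`. -/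
noncomputable def formDomain (α : ℝ) : Submodule ℂ (WithLp 2 (HalfLineL2 × HalfLineL2)) where
  carrier := {p | ∃ u : HalfLineH1, u.InFormDomain α ∧ u.pair = p}
  zero_mem' := ⟨0, fun _ => rfl, HalfLineH1.pair_zero⟩
  add_mem' := by
    rintro p q ⟨u, hu, rfl⟩ ⟨v, hv, rfl⟩
    refine ⟨u + v, fun h0 => ?_, HalfLineH1.pair_add u v⟩
    rw [HalfLineH1.add_toFun, hu h0, hv h0, add_zero]
  smul_mem' := by
    rintro c p ⟨u, hu, rfl⟩
    refine ⟨c • u, fun h0 => ?_, HalfLineH1.pair_smul c u⟩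
    rw [HalfLineH1.smul_toFun, hu h0, mul_zero]

/-- Along a subsequence the functions converge almost everywhere, while the primitives of their
derivatives converge at every point. Hence the values at 0 converge to a constant c, and the limit
is c plus the primitive of the limit derivative. The Dirichlet condition survives because c is the
limit of the boundary values. -/
lemma isClosed_formDomain (α : ℝ) :
    IsClosed (formDomain α : Set (WithLp 2 (HalfLineL2 × HalfLineL2))) := by
  refine IsSeqClosed.isClosed fun p q hp hpq => ?_
  choose u hu hup using hp
  have hfst : Tendsto (fun n => (u n).toL2) atTop (𝓝 q.fst) := by
    have := ((WithLp.prod_continuous_ofLp 2 HalfLineL2 HalfLineL2).fst.tendsto q).comp hpq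
    refine this.congr fun n => ?_
    simp only [Function.comp, ← hup n]
    rfl
  have hsnd : Tendsto (fun n => (u n).derivL2) atTop (𝓝 q.snd) := by
    have := ((WithLp.prod_continuous_ofLp 2 HalfLineL2 HalfLineL2).snd.tendsto q).comp hpq
    refine this.congr fun n => ?_
    simp only [Function.comp, ← hup n]
    rfl
  obtain ⟨φ, hφ, hae⟩ := (tendstoInMeasure_of_tendsto_Lp hfst).exists_seq_tendsto_ae
  have hall : ∀ᵐ x ∂halfLineVolume, ∀ n, (u n).toL2 x = (u n).toFun x :=
    ae_all_iff.2 fun n => (u n).memLp.coeFn_toLp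
  have hpos : ∀ᵐ x ∂halfLineVolume, (0 : ℝ) ≤ x := ae_restrict_mem measurableSet_Ici
  have hint : ∀ x, 0 ≤ x → Tendsto (fun n => ∫ t in (0 : ℝ)..x, (u (φ n)).deriv t) atTop
      (𝓝 (∫ t in (0 : ℝ)..x, q.snd t)) := fun x hx => by
    refine (((continuous_intervalIntegral_halfLineL2 hx).tendsto _).comp
      (hsnd.comp hφ.tendsto_atTop)).congr fun n => ?_
    exact ((u (φ n)).intervalIntegral_deriv le_rfl hx).symm
  have hlim : ∀ᵐ x ∂halfLineVolume, 0 ≤ x ∧ Tendsto (fun n => (u (φ n)).toFun 0) atTop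
      (𝓝 (q.fst x - ∫ t in (0 : ℝ)..x, q.snd t)) := by
    filter_upwards [hae, hall, hpos] with x h1 h2 h3
    refine ⟨h3, (h1.sub (hint x h3)).congr fun n => ?_⟩
    rw [h2, (u (φ n)).eq_add_integral x h3, add_sub_cancel_right]
  have hne : NeBot (ae halfLineVolume) := by
    rw [ae_neBot, halfLineVolume, Ne, Measure.restrict_eq_zero]
    simp
  obtain ⟨x₀, -, hc⟩ := hlim.exists
  set c := q.fst x₀ - ∫ t in (0 : ℝ)..x₀, q.snd t
  have heq : ∀ᵐ x ∂halfLineVolume, q.fst x = c + ∫ t in (0 : ℝ)..x, q.snd t := by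
    filter_upwards [hlim] with x hx
    rw [tendsto_nhds_unique hc hx.2, sub_add_cancel]
  let w : HalfLineH1 :=
    { toFun := fun x => c + ∫ t in (0 : ℝ)..x, q.snd t
      deriv := q.snd
      memLp := (memLp_congr_ae heq).1 (Lp.memLp q.fst)
      memLp_deriv := Lp.memLp q.snd
      eq_add_integral := fun x _ => by simp }
  refine ⟨w, fun h0 => ?_, ?_⟩
  · have : c = 0 := by
      refine tendsto_nhds_unique hc ?_
      simp only [hu _ h0]
      exact tendsto_const_nhds
    simp [w, this]
  · have h1 : w.toL2 = q.fst := Lp.ext ((w.memLp.coeFn_toLp).trans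
      (by filter_upwards [heq] with x hx using hx.symm))
    have h2 : w.derivL2 = q.snd := Lp.toLp_coeFn _ _
    rw [HalfLineH1.pair, h1, h2]
    rfl

instance (α : ℝ) : CompleteSpace (formDomain α) :=
  (isClosed_formDomain α).completeSpace_coe

/-! ### The form as a bounded operator on the form domain -/

namespace HalfLineH1

/-- The bounded continuous function `u v̄` on `[0, ∞)`. -/
noncomputable def mulConj (u v : HalfLineH1) : ℝ≥0 →ᵇ ℂ :=
  BoundedContinuousFunction.ofNormedAddCommGroup (fun x : ℝ≥0 => u.toFun x * conj (v.toFun x))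
    (u.continuous_comp_coe.mul (Complex.continuous_conj.comp v.continuous_comp_coe))
    (2 * ‖u.pair‖ * (2 * ‖v.pair‖)) fun x => by
      rw [norm_mul, RCLike.norm_conj]
      exact mul_le_mul (u.norm_le_two_mul_norm_pair x.2) (v.norm_le_two_mul_norm_pair x.2)
        (norm_nonneg _) (by positivity)

lemma mulConj_apply (u v : HalfLineH1) (x : ℝ≥0) :
    mulConj u v x = u.toFun x * conj (v.toFun x) := rfl

lemma norm_mulConj_le (u v : HalfLineH1) : ‖mulConj u v‖ ≤ 4 * (‖u.pair‖ * ‖v.pair‖) := by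
  refine (BoundedContinuousFunction.norm_le (by positivity)).2 fun x => ?_
  rw [mulConj_apply, norm_mul, RCLike.norm_conj]
  calc _ ≤ 2 * ‖u.pair‖ * (2 * ‖v.pair‖) :=
        mul_le_mul (u.norm_le_two_mul_norm_pair x.2) (v.norm_le_two_mul_norm_pair x.2)
          (norm_nonneg _) (by positivity)
    _ = _ := by ring

lemma norm_mulConj_self_le (u : HalfLineH1) {h : ℝ} (hh : 0 < h) :
    ‖mulConj u u‖ ≤ 2 / h * ‖u.toL2‖ ^ 2 + 2 * h * ‖u.derivL2‖ ^ 2 := by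
  refine (BoundedContinuousFunction.norm_le (by positivity)).2 fun x => ?_
  rw [mulConj_apply, norm_mul, RCLike.norm_conj, ← sq]
  exact u.norm_sq_le hh x.2

/-- The product rule for differences, with Hölder modulus s for one factor and the sup bound 2‖·‖
for the other. Distances are written as s² so that no square roots appear. -/
lemma norm_mulConj_sub_le (u v : HalfLineH1) {s : ℝ} (hs : 0 ≤ s) {x y : ℝ≥0}
    (hxy : |(x : ℝ) - y| ≤ s ^ 2) :
    ‖mulConj u v x - mulConj u v y‖ ≤ 4 * s * (‖u.pair‖ * ‖v.pair‖) := by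
  have hmod : ∀ w : HalfLineH1, ‖w.toFun x - w.toFun y‖ ≤ s * ‖w.pair‖ := fun w => by
    refine le_of_sq_le_sq ((w.norm_sub_sq_le x.2 y.2).trans ?_) (by positivity)
    rw [mul_pow]
    exact mul_le_mul hxy (pow_le_pow_left₀ (norm_nonneg _) w.norm_derivL2_le 2) (sq_nonneg _)
      (sq_nonneg _)
  have h1 : mulConj u v x - mulConj u v y = (u.toFun x - u.toFun y) * conj (v.toFun x) +
      u.toFun y * conj (v.toFun x - v.toFun y) := by
    rw [mulConj_apply, mulConj_apply, map_sub]
    ring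
  rw [h1]
  refine (norm_add_le _ _).trans ?_
  rw [norm_mul, norm_mul, RCLike.norm_conj, RCLike.norm_conj]
  have h2 := mul_le_mul (hmod u) (v.norm_le_two_mul_norm_pair x.2) (norm_nonneg _)
    (by positivity)
  have h3 := mul_le_mul (u.norm_le_two_mul_norm_pair y.2) (hmod v) (norm_nonneg _)
    (by positivity)
  exact (add_le_add h2 h3).trans_eq (by ring)

lemma form_eq (α : ℝ) (μ : SignedMeasure ℝ≥0) (u v : HalfLineH1) :
    form α μ u v = freeForm α u v + signedIntegral μ (mulConj u v) := by
  rw [← integral_vectorMeasure_eq_signedIntegral]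
  rfl

lemma freeForm_eq (α : ℝ) (u v : HalfLineH1) :
    freeForm α u v = inner ℂ v.derivL2 u.derivL2 -
      (if α = 0 then 0 else (Real.cot α : ℂ) * (u.toFun 0 * conj (v.toFun 0))) := by
  rw [freeForm, L2.inner_def]
  congr 1
  refine integral_congr_ae ?_
  filter_upwards [u.memLp_deriv.coeFn_toLp, v.memLp_deriv.coeFn_toLp] with x hu hv
  rw [derivL2, derivL2, hu, hv, RCLike.inner_apply]

lemma conj_form (α : ℝ) (μ : SignedMeasure ℝ≥0) (u v : HalfLineH1) :
    conj (form α μ u v) = form α μ v u := by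
  have hm : ∀ (m : Measure ℝ≥0) [IsFiniteMeasure m],
      conj (∫ x, mulConj u v x ∂m) = ∫ x, mulConj v u x ∂m := fun m _ => by
    rw [← integral_conj]
    refine integral_congr_ae (ae_of_all _ fun x => ?_)
    simp only [mulConj_apply, map_mul, Complex.conj_conj, mul_comm]
  rw [form_eq, form_eq, freeForm_eq, freeForm_eq, signedIntegral_apply, signedIntegral_apply,
    map_add, map_sub, map_sub, inner_conj_symm, hm, hm]
  congr 2
  split_ifs
  · exact map_zero _
  · simp only [map_mul, Complex.conj_conj, Complex.conj_ofReal]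
    ring

lemma form_add_right (α : ℝ) (μ : SignedMeasure ℝ≥0) (u v v' : HalfLineH1) :
    form α μ u (v + v') = form α μ u v + form α μ u v' := by
  rw [← conj_form, form_add_left, map_add, conj_form, conj_form]

lemma form_smul_right (α : ℝ) (μ : SignedMeasure ℝ≥0) (c : ℂ) (u v : HalfLineH1) :
    form α μ u (c • v) = conj c * form α μ u v := by
  rw [← conj_form, form_smul_left, map_mul, conj_form]

lemma norm_form_le (α : ℝ) (μ : SignedMeasure ℝ≥0) (u v : HalfLineH1) :
    ‖form α μ u v‖ ≤ (1 + 4 * |Real.cot α| + 4 * ‖signedIntegral μ‖) * ‖u.pair‖ * ‖v.pair‖ := by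
  have hp : 0 ≤ ‖u.pair‖ * ‖v.pair‖ := by positivity
  have h1 : ‖inner ℂ v.derivL2 u.derivL2‖ ≤ ‖u.pair‖ * ‖v.pair‖ := by
    rw [mul_comm]
    exact (norm_inner_le_norm _ _).trans
      (mul_le_mul v.norm_derivL2_le u.norm_derivL2_le (norm_nonneg _) (norm_nonneg _))
  have h2 : ‖(if α = 0 then 0 else (Real.cot α : ℂ) * (u.toFun 0 * conj (v.toFun 0)))‖ ≤
      4 * |Real.cot α| * (‖u.pair‖ * ‖v.pair‖) := by
    split_ifs
    · rw [norm_zero]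
      positivity
    · rw [norm_mul, norm_mul, RCLike.norm_conj, Complex.norm_real, Real.norm_eq_abs]
      calc _ ≤ |Real.cot α| * (2 * ‖u.pair‖ * (2 * ‖v.pair‖)) := by
            refine mul_le_mul_of_nonneg_left ?_ (abs_nonneg _)
            exact mul_le_mul (u.norm_le_two_mul_norm_pair le_rfl)
              (v.norm_le_two_mul_norm_pair le_rfl) (norm_nonneg _) (by positivity)
        _ = _ := by ring
  have h3 : ‖signedIntegral μ (mulConj u v)‖ ≤
      4 * ‖signedIntegral μ‖ * (‖u.pair‖ * ‖v.pair‖) := by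
    refine ((signedIntegral μ).le_opNorm _).trans ?_
    have := mul_le_mul_of_nonneg_left (norm_mulConj_le u v) (norm_nonneg (signedIntegral μ))
    linarith
  rw [form_eq, freeForm_eq]
  refine (norm_add_le _ _).trans ((add_le_add (norm_sub_le _ _) le_rfl).trans ?_)
  linarith

/-- The form is coercive up to a multiple of the `L²` norm. -/
lemma exists_le_re_form (α : ℝ) (μ : SignedMeasure ℝ≥0) : ∃ C : ℝ, ∀ u : HalfLineH1,
    1 / 2 * ‖u.pair‖ ^ 2 ≤ (form α μ u u).re + C * ‖u.toL2‖ ^ 2 := by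
  set K := |Real.cot α| + ‖signedIntegral μ‖ with hK
  have hK0 : 0 ≤ K := by positivity
  -- Chosen so that 2hK ≤ 1/2: the boundary and measure terms together absorb at most half of ‖u'‖².
  -- The extra 1/2 in C below pays for the L² part of ‖u.pair‖².
  set h := 1 / (4 * (K + 1)) with hh
  have hh0 : 0 < h := by positivity
  refine ⟨1 / 2 + K * (2 / h), fun u => ?_⟩
  have e1 : (inner ℂ u.derivL2 u.derivL2 : ℂ).re = ‖u.derivL2‖ ^ 2 :=
    inner_self_eq_norm_sq (𝕜 := ℂ) _
  set S := 2 / h * ‖u.toL2‖ ^ 2 + 2 * h * ‖u.derivL2‖ ^ 2 with hS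
  have e2 : (if α = 0 then 0 else (Real.cot α : ℂ) * (u.toFun 0 * conj (u.toFun 0))).re ≤
      |Real.cot α| * S := by
    have hS0 : 0 ≤ S := by positivity
    split_ifs
    · rw [Complex.zero_re]
      positivity
    · refine (Complex.re_le_norm _).trans ?_
      rw [norm_mul, norm_mul, RCLike.norm_conj, Complex.norm_real, Real.norm_eq_abs, ← sq]
      exact mul_le_mul_of_nonneg_left (u.norm_sq_le hh0 le_rfl) (abs_nonneg _)
  have e3 : -(signedIntegral μ (mulConj u u)).re ≤ ‖signedIntegral μ‖ * S :=
    (neg_le_abs _).trans ((Complex.abs_re_le_norm _).trans (((signedIntegral μ).le_opNorm _).trans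
      (mul_le_mul_of_nonneg_left (u.norm_mulConj_self_le hh0) (norm_nonneg _))))
  have e4 : K * (2 * h) ≤ 1 / 2 := by
    rw [hh]
    field_simp
    linarith
  have e5 : K * (2 * h) * ‖u.derivL2‖ ^ 2 ≤ 1 / 2 * ‖u.derivL2‖ ^ 2 :=
    mul_le_mul_of_nonneg_right e4 (sq_nonneg _)
  have e6 : K * S = K * (2 / h) * ‖u.toL2‖ ^ 2 + K * (2 * h) * ‖u.derivL2‖ ^ 2 := by
    rw [hS]
    ring
  have e7 : K * S = |Real.cot α| * S + ‖signedIntegral μ‖ * S := add_mul _ _ _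
  rw [form_eq, freeForm_eq, norm_pair_sq, Complex.add_re, Complex.sub_re, e1]
  linarith

/-- `HalfLineH1` consists of functions rather than classes. This makes the form well defined on
classes: continuity forces the function to vanish on the half-line, hence its derivative almost
everywhere. -/
lemma form_eq_zero_of_toL2_eq_zero (α : ℝ) (μ : SignedMeasure ℝ≥0) {u : HalfLineH1}
    (hu : u.toL2 = 0) (v : HalfLineH1) : form α μ u v = 0 := by
  have h1 : u.derivL2 = 0 := by
    refine (Lp.eq_zero_iff_ae_eq_zero).2 ?_
    filter_upwards [u.memLp_deriv.coeFn_toLp, u.deriv_ae_eq_zero hu] with x h2 h3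
    rw [derivL2, h2, h3]
    rfl
  have h2 : mulConj u v = 0 := by
    ext x
    rw [mulConj_apply, u.toFun_eq_zero hu x x.2, zero_mul]
    rfl
  rw [form_eq, freeForm_eq, h1, h2, u.toFun_eq_zero hu 0 le_rfl]
  simp

lemma form_congr_left (α : ℝ) (μ : SignedMeasure ℝ≥0) {u u' : HalfLineH1}
    (h : u.toL2 = u'.toL2) (v : HalfLineH1) : form α μ u v = form α μ u' v := by
  have h0 : (u + (-1 : ℂ) • u').toL2 = 0 := by
    rw [toL2_add, toL2_smul, h, neg_one_smul, add_neg_cancel]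
  have h1 := form_eq_zero_of_toL2_eq_zero α μ h0 v
  rw [form_add_left, form_smul_left] at h1
  linear_combination h1

lemma form_congr (α : ℝ) (μ : SignedMeasure ℝ≥0) {u u' v v' : HalfLineH1}
    (hu : u.toL2 = u'.toL2) (hv : v.toL2 = v'.toL2) : form α μ u v = form α μ u' v' := by
  rw [form_congr_left α μ hu, ← conj_form, form_congr_left α μ hv, conj_form]

end HalfLineH1

/-! ### The operator representing the form -/

namespace formDomain

variable {α : ℝ}

/-- A representative of an element of the form domain. -/
noncomputable def rep (p : formDomain α) : HalfLineH1 := p.2.choose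

lemma rep_inFormDomain (p : formDomain α) : (rep p).InFormDomain α := p.2.choose_spec.1

lemma pair_rep (p : formDomain α) : (rep p).pair = p := p.2.choose_spec.2

lemma norm_pair_rep (p : formDomain α) : ‖(rep p).pair‖ = ‖p‖ := by
  rw [pair_rep]
  rfl

/-- The embedding of the form domain into `L²`. -/
noncomputable def toL2 (α : ℝ) : formDomain α →L[ℂ] HalfLineL2 :=
  WithLp.fstL 2 ℂ HalfLineL2 HalfLineL2 ∘L (formDomain α).subtypeL

lemma toL2_rep (p : formDomain α) : (rep p).toL2 = toL2 α p :=
  congrArg WithLp.fst (pair_rep p)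

/-- Chosen representatives need not add up as functions. Equality in L² is enough, by
`HalfLineH1.form_congr`. -/
lemma toL2_rep_add (p q : formDomain α) : (rep (p + q)).toL2 = (rep p + rep q).toL2 := by
  rw [HalfLineH1.toL2_add, toL2_rep, toL2_rep, toL2_rep, map_add]

lemma toL2_rep_smul (c : ℂ) (p : formDomain α) : (rep (c • p)).toL2 = (c • rep p).toL2 := by
  rw [HalfLineH1.toL2_smul, toL2_rep, toL2_rep, map_smul]

lemma exists_toL2_rep_eq {u : HalfLineH1} (hu : u.InFormDomain α) :
    ∃ p : formDomain α, (rep p).toL2 = u.toL2 :=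
  ⟨⟨u.pair, u, hu, rfl⟩, toL2_rep _⟩

/-- The form as a bounded sesquilinear map, antilinear in the first argument. -/
noncomputable def sesqForm (α : ℝ) (μ : SignedMeasure ℝ≥0) :
    formDomain α →L⋆[ℂ] formDomain α →L[ℂ] ℂ :=
  LinearMap.mkContinuous₂
    (LinearMap.mk₂'ₛₗ (starRingEnd ℂ) (RingHom.id ℂ)
      (fun p q => HalfLineH1.form α μ (rep q) (rep p))
      (fun p p' q => by
        rw [HalfLineH1.form_congr α μ rfl (toL2_rep_add p p'), HalfLineH1.form_add_right])
      (fun c p q => by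
        rw [HalfLineH1.form_congr α μ rfl (toL2_rep_smul c p), HalfLineH1.form_smul_right,
          smul_eq_mul])
      (fun p q q' => by
        rw [HalfLineH1.form_congr α μ (toL2_rep_add q q') rfl, HalfLineH1.form_add_left])
      (fun c p q => by
        rw [HalfLineH1.form_congr α μ (toL2_rep_smul c q) rfl, HalfLineH1.form_smul_left,
          RingHom.id_apply, smul_eq_mul]))
    (1 + 4 * |Real.cot α| + 4 * ‖signedIntegral μ‖)
    (fun p q => by
      have := HalfLineH1.norm_form_le α μ (rep q) (rep p)
      rw [norm_pair_rep, norm_pair_rep, mul_right_comm] at this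
      exact this)

/-- The bounded operator on the form domain that represents the form. -/
noncomputable def operator (α : ℝ) (μ : SignedMeasure ℝ≥0) : formDomain α →L[ℂ] formDomain α :=
  InnerProductSpace.continuousLinearMapOfBilin (sesqForm α μ)

lemma inner_operator_left (μ : SignedMeasure ℝ≥0) (p q : formDomain α) :
    inner ℂ (operator α μ p) q = HalfLineH1.form α μ (rep q) (rep p) :=
  InnerProductSpace.continuousLinearMapOfBilin_apply _ _ _

lemma inner_operator_right (μ : SignedMeasure ℝ≥0) (p q : formDomain α) :
    inner ℂ p (operator α μ q) = HalfLineH1.form α μ (rep q) (rep p) := by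
  refine (inner_conj_symm (𝕜 := ℂ) (E := formDomain α) p (operator α μ q)).symm.trans ?_
  rw [inner_operator_left, HalfLineH1.conj_form]

lemma operator_symmetric (μ : SignedMeasure ℝ≥0) (p q : formDomain α) :
    inner ℂ (operator α μ p) q = inner ℂ p (operator α μ q) := by
  rw [inner_operator_left, inner_operator_right]

lemma exists_le_re_inner_operator (α : ℝ) (μ : SignedMeasure ℝ≥0) : ∃ C : ℝ, ∀ p : formDomain α,
    1 / 2 * ‖p‖ ^ 2 ≤ (inner ℂ (operator α μ p) p).re + C * ‖toL2 α p‖ ^ 2 := by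
  obtain ⟨C, hC⟩ := HalfLineH1.exists_le_re_form α μ
  refine ⟨C, fun p => ?_⟩
  rw [inner_operator_left, ← toL2_rep, ← norm_pair_rep]
  exact hC _

/-- Tested against q, the weak equation says ⟨q, A p⟩ = ⟨J q, h⟩ = ⟨q, J* h⟩, with J the embedding
into L². -/
lemma mem_graph_schrodingerOperator (μ : SignedMeasure ℝ≥0) (f h : HalfLineL2) :
    (f, h) ∈ (schrodingerOperator α μ).graph ↔
      ∃ p, toL2 α p = f ∧ operator α μ p = ContinuousLinearMap.adjoint (toL2 α) h := by
  rw [schrodingerOperator_graph]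
  constructor
  · rintro ⟨u, hu, huf, huh⟩
    obtain ⟨p, hp⟩ := exists_toL2_rep_eq hu
    refine ⟨p, by rw [← toL2_rep, hp]; exact huf, ext_inner_left ℂ fun q => ?_⟩
    rw [inner_operator_right, HalfLineH1.form_congr α μ hp rfl, huh _ (rep_inFormDomain q),
      ContinuousLinearMap.adjoint_inner_right, toL2_rep]
  · rintro ⟨p, hpf, hph⟩
    refine ⟨rep p, rep_inFormDomain p, (toL2_rep p).trans hpf, fun v hv => ?_⟩
    obtain ⟨q, hq⟩ := exists_toL2_rep_eq hv
    rw [HalfLineH1.form_congr α μ rfl hq.symm, ← inner_operator_right, hph,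
      ContinuousLinearMap.adjoint_inner_right, ← toL2_rep, hq]

/-- Weak convergence of the measures implies norm convergence of the operators that represent the
forms. -/
lemma tendsto_operator {μs : ℕ → SignedMeasure ℝ≥0} {μ : SignedMeasure ℝ≥0}
    (h : SignedWeakConverges μs μ) :
    Tendsto (fun n => operator α (μs n)) atTop (𝓝 (operator α μ)) := by
  obtain ⟨M, hM, hunif⟩ := h.exists_eventually_le
  refine tendsto_of_forall_norm_inner_sub_le fun ε hε => ?_
  -- With mesh 1 / r = s² the products have modulus δ = 4s‖p‖‖q‖, so M δ costs at most half of
  -- ε‖p‖‖q‖. The tolerance ε / 8 times the sup bound 4‖p‖‖q‖ costs the other half.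
  set s := ε / (8 * (M + 1)) with hs
  have hs0 : 0 < s := by positivity
  filter_upwards [hunif (1 / s ^ 2) (by positivity) (ε / 8) (by positivity)] with n hn p q
  have h2 := hn (HalfLineH1.mulConj (rep p) (rep q)) (4 * s * (‖(rep p).pair‖ * ‖(rep q).pair‖))
    (by positivity) fun x y hxy =>
      HalfLineH1.norm_mulConj_sub_le _ _ hs0.le (by simpa using hxy)
  have h3 := HalfLineH1.norm_mulConj_le (rep p) (rep q)
  rw [norm_pair_rep, norm_pair_rep] at h2 h3
  have h4 : M * s ≤ ε / 8 := by
    rw [hs, ← mul_div_assoc, div_le_div_iff₀ (by positivity) (by positivity)]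
    nlinarith
  -- The free forms cancel; only the integral against the difference of the measures remains.
  rw [inner_operator_right, inner_operator_right, HalfLineH1.form_eq, HalfLineH1.form_eq,
    add_sub_add_left_eq_sub]
  have e1 := mul_le_mul_of_nonneg_right h4 (mul_nonneg (norm_nonneg p) (norm_nonneg q))
  have e2 := mul_le_mul_of_nonneg_left h3 (show 0 ≤ ε / 8 by positivity)
  linarith

end formDomain

/-! ### The main theorem -/

open formDomain in
theorem mainTheorem5 (α : ℝ) (hα : α ∈ Set.Ico 0 Real.pi)
    (μs : ℕ → SignedMeasure ℝ≥0) (μ : SignedMeasure ℝ≥0)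
    (hμs0 : ∀ n, μs n {0} = 0) (hμ0 : μ {0} = 0)
    (hweak : SignedWeakConverges μs μ) :
    (∀ n, IsSelfAdjoint (schrodingerOperator α (μs n))) ∧
      IsSelfAdjoint (schrodingerOperator α μ) ∧
      NormResolventConverges (fun n => schrodingerOperator α (μs n))
        (schrodingerOperator α μ) := by
  have hsa : ∀ ν : SignedMeasure ℝ≥0, IsSelfAdjoint (schrodingerOperator α ν) := fun ν => by
    obtain ⟨C, hC⟩ := exists_le_re_inner_operator α ν
    exact isSelfAdjoint_of_form (operator_symmetric ν) one_half_pos hC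
      (mem_graph_schrodingerOperator ν)
  refine ⟨fun n => hsa _, hsa μ, fun z hz => ?_⟩
  have hT : ∀ ν : SignedMeasure ℝ≥0, IsUnit (operator α ν -
      z • (ContinuousLinearMap.adjoint (toL2 α) ∘L toL2 α)) := fun ν => by
    obtain ⟨C, hC⟩ := exists_le_re_inner_operator α ν
    exact isUnit_sub_smul_adjoint_comp (operator_symmetric ν) one_half_pos hC hz
  exact ⟨fun n => formResolvent (toL2 α) (operator α (μs n)) z,
    formResolvent (toL2 α) (operator α μ) z,
    fun n => isResolventAt_formResolvent (mem_graph_schrodingerOperator _) (hT _),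
    isResolventAt_formResolvent (mem_graph_schrodingerOperator _) (hT _),
    tendsto_formResolvent (toL2 α) (hT μ) (tendsto_operator hweak)⟩
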